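/- Let $C\ge 1$ be an odd integer and $j_c=\lceil C/2\rceil$. Let $\mathbb T^b$ be the infinite rooted $b$-ary tree (the root has $b$ neighbours, every other vertex has $b+1$), with vertex set $V$. For an activity $\lambda>0$, consider the multi-state hard core model on $\mathbb T^b$: spins $\sigma_v\in\{0,\dots,C\}$, with $\sigma_x+\sigma_y\le C$ for all adjacent $x,y$, and weight $\lambda^{\sigma_v}$ at each vertex $v$. A Gibbs measure is a probability measure $\mu$ on $\{0,\dots,C\}^V$ (with the product $\sigma$-algebra) such that for every finite $U\subset V$ the conditional distribution of $\sigma_U$, given the spins outside $U$ to be $\tau$, is for $\mu$-a.e. $\tau$ the law on configurations $\xi$ on $U$ proportional to $\prod_{v\in U}\lambda^{\xi_v}$, restricted to those $\xi$ which together with $\tau$ on $\partial U$ are allowed on the subgraph induced by $U\cup\partial U$. There is phase coexistence at $\lambda$ if there are at least two Gibbs measures. For $\lambda<1$ put $A=A_\lambda=(1-\lambda)^{-1}$, $\lambda^-=A^{-1}\lambda^{j_c}$, $\lambda^+=A\lambda^{j_c}$, and for $\alpha\geq 0$, $x\ge 0$ put $J^{(\alpha)}(x)=\alpha/(1+x)^b$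 and $J_2^{(\alpha)}=J^{(\alpha)}\circ J^{(\alpha)}$. **Theorem.** 1. Let $\gamma>e$. (a) For every $\bar\lambda<1$ there is $b_0=b_0(C,\gamma,\bar\lambda)$ such that for all integers $b\ge b_0$ and all $\lambda$ with $(\gamma/b)^{1/j_c}\le\lambda\le\bar\lambda$, the smallest fixed point in $[0,\infty)$ of $x\mapsto A^2J_2^{(\lambda^-)}(x)$ and the largest fixed point in $[0,\infty)$ of $x\mapsto A^{-2}J_2^{(\lambda^+)}(x)$ exist, and the former is strictly smaller than the latter. (b) There is $b_0=b_0(C,\gamma)$ such that for all integers $b\ge b_0$ and all $\lambda$ with $(\gamma/b)^{1/j_c}\le\lambda<1$ there is phase coexistence at $\lambda$ on $\mathbb T^b$. 2. Let $0<\gamma'<e$. There is $b_0=b_0(C,\gamma')$ such that for all integers $b\ge b_0$ and all $\lambda$ with $0<\lambda\le(\gamma'/b)^{1/j_c}$ there is exactly one Gibbs measure on $\mathbb T^b$ at $\lambda$. -/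

import Mathlib

noncomputable section

namespace MultiHardCore

open MeasureTheory

/-! The multi-state hard core model: spins in `{0, …, C}`, activities `λ ^ i`. -/

/-- The infinite rooted `b`-ary tree. A vertex is the list of choices made on the way down from
the root `[]` (latest choice first); the children of `v` are the `b` lists `i :: v`. -/
def tree (b : ℕ) : SimpleGraph (List (Fin b)) where
  Adj u v := (∃ i, u = i :: v) ∨ (∃ i, v = i :: u)
  symm := ⟨fun _ _ h => h.symm⟩
  loopless := ⟨fun u h => by
    rcases h with ⟨i, h⟩ | ⟨i, h⟩ <;> exact absurd (congrArg List.length h) (by simp)⟩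

variable {V : Type*}

/-- The outer vertex boundary of a finite set of vertices. -/
def boundary (G : SimpleGraph V) (U : Finset V) : Set V :=
  {x | x ∉ U ∧ ∃ z ∈ U, G.Adj x z}

/-- The closure `U ∪ ∂U`. -/
def closedHull (G : SimpleGraph V) (U : Finset V) : Set V :=
  (U : Set V) ∪ boundary G U

/-- `σ` is an allowed configuration on the induced graph `G[W]`: adjacent spins add up to at
most `C`. -/
def AllowedOn (G : SimpleGraph V) (C : ℕ) (W : Set V) (σ : V → Fin (C + 1)) : Prop :=
  ∀ x ∈ W, ∀ y ∈ W, G.Adj x y → (σ x : ℕ) + (σ y : ℕ) ≤ C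

open Classical in
/-- The configuration equal to `ξ` on `U` and to `τ` off `U`. -/
def glue {C : ℕ} (U : Finset V) (ξ : U → Fin (C + 1)) (τ : V → Fin (C + 1)) :
    V → Fin (C + 1) :=
  fun v => if h : v ∈ U then ξ ⟨v, h⟩ else τ v

open Classical in
/-- The unnormalized weight of `ξ` on `U` with boundary condition `τ`: the product of the
activities over `U` if the glued configuration is allowed on `G[U ∪ ∂U]`, and `0` otherwise.
(The activities of the boundary vertices are a common factor, which cancels on conditioning.) -/
def localWeight (G : SimpleGraph V) (C : ℕ) (lam : ℝ) (U : Finset V)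
    (ξ : U → Fin (C + 1)) (τ : V → Fin (C + 1)) : ℝ :=
  if AllowedOn G C (closedHull G U) (glue U ξ τ) then ∏ v : U, lam ^ (ξ v : ℕ) else 0

open Classical in
/-- The probability of `ξ` under the stationary distribution of the model on the finite graph
`G[U ∪ ∂U]`, conditioned on the configuration `τ` on `∂U`. -/
def condProb (G : SimpleGraph V) (C : ℕ) (lam : ℝ) (U : Finset V)
    (ξ : U → Fin (C + 1)) (τ : V → Fin (C + 1)) : ℝ :=
  localWeight G C lam U ξ τ / ∑ η : U → Fin (C + 1), localWeight G C lam U η τ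

/-- Gibbs measures of the multi-state hard core model with activity `lam` on `G`: probability
measures on the space of all configurations, with the product sigma-algebra, whose conditional
distribution on each finite `U`, given the spins outside `U`, is `condProb`. -/
structure IsGibbs (G : SimpleGraph V) (C : ℕ) (lam : ℝ)
    (μ : Measure (V → Fin (C + 1))) : Prop where
  isProbabilityMeasure : IsProbabilityMeasure μ
  condExp_eq : ∀ (U : Finset V) (ξ : U → Fin (C + 1)),
    condExp (cylinderEvents ((U : Set V)ᶜ)) μ
      (Set.indicator {σ : V → Fin (C + 1) | ∀ v : U, σ v = ξ v} (fun _ => (1 : ℝ)))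
      =ᵐ[μ] fun τ => condProb G C lam U ξ τ

/-- There are several Gibbs measures. -/
def PhaseCoexistence (G : SimpleGraph V) (C : ℕ) (lam : ℝ) : Prop :=
  ∃ μ ν : Measure (V → Fin (C + 1)), IsGibbs G C lam μ ∧ IsGibbs G C lam ν ∧ μ ≠ ν

/-- The one-level map of the usual hard core model. -/
def J (b : ℕ) (lam x : ℝ) : ℝ := lam / (1 + x) ^ b

/-- The two-level map of the usual hard core model. -/
def J₂ (b : ℕ) (lam x : ℝ) : ℝ := J b lam (J b lam x)

/-- `A_λ = ∑ λ ^ i = (1 - λ)⁻¹`, for `0 ≤ λ < 1`. -/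
def A (lam : ℝ) : ℝ := (1 - lam)⁻¹

/-- `j_c = ⌈C / 2⌉`. -/
def jc (C : ℕ) : ℕ := ⌈(C : ℝ) / 2⌉₊

/-- `λ⁻ = A⁻¹ λ ^ j_c`. -/
def lamMinus (C : ℕ) (lam : ℝ) : ℝ := (A lam)⁻¹ * lam ^ jc C

/-- `λ⁺ = A λ ^ j_c`. -/
def lamPlus (C : ℕ) (lam : ℝ) : ℝ := A lam * lam ^ jc C

/-- The upper bounding map `x ↦ A² J₂^(λ⁻)(x)`. -/
def upperMap (b C : ℕ) (lam x : ℝ) : ℝ := A lam ^ 2 * J₂ b (lamMinus C lam) x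

/-- The lower bounding map `x ↦ A⁻² J₂^(λ⁺)(x)`. -/
def lowerMap (b C : ℕ) (lam x : ℝ) : ℝ := (A lam ^ 2)⁻¹ * J₂ b (lamPlus C lam) x

/-- The fixed points in `[0, ∞)` of a map. -/
def fixedPts (f : ℝ → ℝ) : Set ℝ := {x | 0 ≤ x ∧ f x = x}

end MultiHardCore

end

/-!
# Phase transition of the multi-state hard core model on the `b`-ary tree

Write `p = ⌈C / 2⌉`, so that `C + 1 = 2 p`, call the spins `0, …, p - 1` low and `p, …, C` high, and
let `x` be the ratio of the weights of high and low spins at the root of a subtree. A high spin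
forces low spins on all children, and a low spin excludes only high spins; up to a factor
`a = ∑ i < p, λ ^ i`, the model is therefore the usual hard core model with activity `λ ^ p`:
passing to the parent, `x` becomes `λ ^ p / (1 + x) ^ b`, up to the factors `a` and `a⁻¹`. With
`s = b x` and `m = b λ ^ p` this is nearly `s ↦ m e ^ (-s)`, whose two-step map has a repelling fixed
point for `m > e` and is a contraction for `m < e`.

*Above `e`.* For `x = 1 / b` and `y = λ ^ p / (a e)` the two inequalities
`a λ ^ p ≤ x (1 + y) ^ b` and `a y (1 + x) ^ b ≤ λ ^ p` hold with `x < y` (`exists_trap`). They say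
that the two-step bounding maps preserve `[0, x]` and `[y, ∞)`, and this separates the fixed points
(`extremal_fixedPts_of_trap`, with `(1 - λ)⁻¹` in place of `a`). They also say that, with boundary condition `0` at distance `n` from
the root, the ratio at the root is at most `x` for even `n` and at least `y` for odd `n`
(`iterate_homStep_trapped`). The space of probability measures on configurations is compact, and
limit points of finite-volume measures are Gibbs measures (`exists_isGibbs_tendsto`); limit points
along even and along odd `n` differ (`phaseCoexistence_of_trap`). As `a` is bounded by `p` and by
`(1 - λ)⁻¹`, everything is uniform in `λ < 1`.

*Below `e`.* Summing out the spins level by level expresses finite-volume marginals through the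
weights of subtrees (`siteSum_hullWeight_ball`), so that it is enough to show that these, normalized,
have a limit independent of the boundary condition. The recursion reverses the order `Dominated`,
and the two extremal boundary conditions generate a single sequence `extremal`, whose consecutive
members enclose all boundary conditions (`subtreeWeight_between`). For the distribution function
`F` of the spin at the root, put `θ k = F k ^ (b / 2)`. For the map `s ↦ m e ^ (-s)` the coordinate
`θ` is `√s` up to scaling and a shift by one step, and there already a single step is a contraction,
with factor `√(m / e)` (`decay_sq_sub_le`). For the full recursion the coordinate `k = p - 1` plays
this role; the other coordinates are controlled by a weighted supremum norm, at the cost of a small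
activity (`thetaStep_sub_le`). Here it is essential to compare ordered pairs only, since this gives
the terms that decrease the difference the right sign. Hence the extremal sequence converges
(`exists_tendsto_distFn_extremal`), and with it the marginals of every Gibbs measure are determined
(`existsUnique_isGibbs_of_subcritical`).
-/

noncomputable section

namespace MultiHardCore

open MeasureTheory

/-! ### Separation of the fixed points of the bounding maps -/

lemma exp_mul_le_mul_exp {G r : ℝ} (hG : 1 ≤ G) (hr : G ≤ r) :
    Real.exp G * r ≤ G * Real.exp r := by
  have h1 : Real.exp r = Real.exp G * Real.exp (r - G) := by
    rw [← Real.exp_add]; congr 1; ring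
  have h2 : r - G + 1 ≤ Real.exp (r - G) := Real.add_one_le_exp _
  have h3 : r ≤ G * Real.exp (r - G) := by nlinarith
  rw [h1]
  have := Real.exp_pos G
  nlinarith

/-- The strict inequality `e g < e ^ g` for `g > 1` survives a small loss `k` in the constants. -/
lemma exists_slack {g : ℝ} (hg : 1 < g) :
    ∃ k : ℝ, 0 < k ∧ k < 1 ∧ 1 < k * g ∧ Real.exp 1 * (k * g) ≤ k ^ 2 * Real.exp (k * g) := by
  have hlt : Real.exp 1 * g < Real.exp g := by
    have h1 : Real.exp g = Real.exp 1 * Real.exp (g - 1) := by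
      rw [← Real.exp_add]; congr 1; ring
    have h2 : g - 1 + 1 < Real.exp (g - 1) := Real.add_one_lt_exp (by linarith)
    rw [h1]
    exact mul_lt_mul_of_pos_left (by linarith) (Real.exp_pos 1)
  have hc : ContinuousAt (fun k : ℝ => k ^ 2 * Real.exp (k * g) - Real.exp 1 * (k * g)) 1 := by
    fun_prop
  have hc' : ContinuousAt (fun k : ℝ => k * g) 1 := by fun_prop
  have e1 := hc.eventually (lt_mem_nhds (a := (0 : ℝ)) (by simpa using hlt))
  have e2 := hc'.eventually (lt_mem_nhds (a := (1 : ℝ)) (by simpa using hg))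
  have e3 := lt_mem_nhds (show (0 : ℝ) < 1 by norm_num)
  obtain ⟨k, ⟨⟨h1, h2⟩, h3⟩, h4⟩ :=
    ((((e1.and e2).and e3).filter_mono nhdsWithin_le_nhds).and
      (self_mem_nhdsWithin : Set.Iio (1 : ℝ) ∈ nhdsWithin 1 (Set.Iio 1))).exists
  exact ⟨k, h3, h4, h2, by linarith⟩

lemma one_add_one_div_pow_le_exp {b : ℕ} : (1 + 1 / (b : ℝ)) ^ b ≤ Real.exp 1 := by
  rcases Nat.eq_zero_or_pos b with rfl | hb
  · simp
  have hb' : (0 : ℝ) < b := by exact_mod_cast hb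
  calc (1 + 1 / (b : ℝ)) ^ b ≤ (Real.exp (1 / b)) ^ b := by
        gcongr
        linarith [Real.add_one_le_exp (1 / (b : ℝ))]
    _ = Real.exp 1 := by
        rw [← Real.exp_nat_mul]
        congr 1
        field_simp

/-- Beyond the critical value `e` of `b λ ^ p` there are, for large `b`, two separated values that
trap the two-level recursion. The constant `a` bounds the distortion of the recursion; all
estimates are uniform in it as long as it is bounded and tends to `1` with `λ → 0`. -/
lemma exists_trap {γ K : ℝ} (hγ : Real.exp 1 < γ) (hK : 1 ≤ K) {p : ℕ} (hp : 1 ≤ p) :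
    ∃ b₀ : ℕ, 1 ≤ b₀ ∧ ∀ b : ℕ, b₀ ≤ b → ∀ lam a : ℝ, 0 < lam → lam < 1 → 1 ≤ a → a ≤ K →
      a ≤ (1 - lam)⁻¹ → γ ≤ b * lam ^ p →
      ∃ x y : ℝ, 0 < x ∧ x < y ∧ a * lam ^ p ≤ x * (1 + y) ^ b ∧
        a * (y * (1 + x) ^ b) ≤ lam ^ p := by
  have he := Real.exp_pos 1
  obtain ⟨k, hk0, hk1, hkg, hkG⟩ := exists_slack (g := γ / Real.exp 1) ((one_lt_div he).2 hγ)
  -- for `λ ≤ ε` both distortions, of `a` and of `log (1 + y)`, are at most `1 - ε = √k`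
  set ε : ℝ := 1 - Real.sqrt k with hε
  have hsk : Real.sqrt k ^ 2 = k := Real.sq_sqrt hk0.le
  have hsk0 : 0 < Real.sqrt k := Real.sqrt_pos.2 hk0
  have hsk1 : Real.sqrt k < 1 := by
    rw [Real.sqrt_lt' one_pos]; simpa using hk1
  have hε0 : 0 < ε := by linarith
  set η : ℝ := ε ^ p / (K * Real.exp 1) with hη
  have hη0 : 0 < η := by positivity
  have t1 : ∀ᶠ b : ℕ in Filter.atTop, K * (b : ℝ) ≤ (1 + η) ^ b := by
    have := (tendsto_pow_const_div_const_pow_of_one_lt 1 (r := 1 + η) (by linarith)).eventually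
      (gt_mem_nhds (show (0 : ℝ) < 1 / K by positivity))
    filter_upwards [this] with b hb
    rw [div_lt_div_iff₀ (by positivity) (by linarith)] at hb
    linarith
  have t2 : ∀ᶠ b : ℕ in Filter.atTop, K * Real.exp 1 / ε ^ p < b :=
    tendsto_natCast_atTop_atTop.eventually (Filter.eventually_gt_atTop _)
  obtain ⟨b₁, hb₁⟩ := Filter.eventually_atTop.1 (t1.and t2)
  refine ⟨max 1 b₁, le_max_left _ _, fun b hb lam a hl0 hl1 ha1 haK haA hm => ?_⟩
  have hb1 : 1 ≤ b := le_trans (le_max_left _ _) hb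
  obtain ⟨h1, h2⟩ := hb₁ b (le_trans (le_max_right _ _) hb)
  have hb0 : (0 : ℝ) < b := by exact_mod_cast hb1
  set μ := lam ^ p with hμ
  have hμ0 : 0 < μ := by positivity
  have hμ1 : μ ≤ lam := by
    calc lam ^ p ≤ lam ^ 1 := pow_le_pow_of_le_one hl0.le hl1.le hp
      _ = lam := pow_one _
  have ha0 : 0 < a := by linarith
  have hy0 : 0 < μ / (a * Real.exp 1) := by positivity
  suffices hs : a * Real.exp 1 < b * μ ∧ a * (b * μ) ≤ (1 + μ / (a * Real.exp 1)) ^ b by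
    refine ⟨1 / b, μ / (a * Real.exp 1), by positivity, ?_, ?_, ?_⟩
    · rw [div_lt_div_iff₀ hb0 (by positivity)]
      linarith [hs.1]
    · rw [div_mul_eq_mul_div, one_mul, le_div_iff₀ hb0]
      linarith [hs.2]
    · calc a * (μ / (a * Real.exp 1) * (1 + 1 / (b : ℝ)) ^ b)
          ≤ a * (μ / (a * Real.exp 1) * Real.exp 1) := by
            gcongr
            exact one_add_one_div_pow_le_exp
        _ = μ := by field_simp
  rcases le_or_gt lam ε with hle | hgt
  · set q := b * μ / Real.exp 1 with hq
    have hqe : b * μ = q * Real.exp 1 := by rw [hq]; field_simp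
    have hqg : γ / Real.exp 1 ≤ q := by rw [hq]; gcongr
    have hq0 : 0 < q := by positivity
    have hinv : a * Real.sqrt k ≤ 1 := by
      have h3 : Real.sqrt k ≤ 1 - lam := by linarith
      calc a * Real.sqrt k ≤ (1 - lam)⁻¹ * (1 - lam) := by
            apply mul_le_mul haA h3 hsk0.le (by rw [inv_nonneg]; linarith)
        _ = 1 := inv_mul_cancel₀ (by linarith)
    have hak : a * k ≤ 1 := by
      calc a * k = (a * Real.sqrt k) * Real.sqrt k := by nth_rewrite 1 [← hsk]; ring
        _ ≤ 1 * 1 := by gcongr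
        _ = 1 := one_mul 1
    constructor
    · rw [hqe]
      have : k * (γ / Real.exp 1) ≤ k * q := by gcongr
      have haq : a < q := by
        have h3 : a * k < q * k := by linarith
        exact lt_of_mul_lt_mul_right h3 hk0.le
      exact mul_lt_mul_of_pos_right haq he
    · set y := μ / (a * Real.exp 1) with hy
      have hya : a * y * b = q := by rw [hy, hq]; field_simp
      have hyε : y ≤ ε := by
        rw [hy, div_le_iff₀ (by positivity)]
        have : (1 : ℝ) ≤ Real.exp 1 := by linarith [Real.add_one_le_exp (1 : ℝ)]
        have h3 : 1 ≤ a * Real.exp 1 := one_le_mul_of_one_le_of_one_le ha1 this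
        calc μ ≤ ε * 1 := by linarith
          _ ≤ _ := by gcongr
      have hlog : Real.sqrt k * y ≤ Real.log (1 + y) := by
        have h4 := Real.one_sub_inv_le_log_of_pos (show 0 < 1 + y by linarith)
        have h5 : Real.sqrt k * y ≤ 1 - (1 + y)⁻¹ := by
          have : 1 - (1 + y)⁻¹ = y / (1 + y) := by field_simp; ring
          rw [this, le_div_iff₀ (by linarith)]
          have : Real.sqrt k * (1 + y) ≤ 1 := by
            have hke : Real.sqrt k = 1 - ε := by rw [hε]; ring
            have hk' : 0 ≤ 1 - ε := by linarith
            calc Real.sqrt k * (1 + y) ≤ (1 - ε) * (1 + ε) := by rw [hke]; gcongr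
              _ = 1 - ε ^ 2 := by ring
              _ ≤ 1 := by linarith [sq_nonneg ε]
          calc Real.sqrt k * y * (1 + y) = y * (Real.sqrt k * (1 + y)) := by ring
            _ ≤ y * 1 := by gcongr
            _ = y := mul_one y
        linarith
      have hkq : k * q ≤ b * Real.log (1 + y) := by
        have h6 : k * q ≤ b * (Real.sqrt k * y) := by
          rw [← hya]
          have h7 : k * a ≤ Real.sqrt k := by
            calc k * a = Real.sqrt k * (a * Real.sqrt k) := by
                  nth_rewrite 1 [← hsk]; ring
              _ ≤ Real.sqrt k * 1 := by gcongr
              _ = _ := mul_one _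
          calc k * (a * y * b) = (k * a) * (y * b) := by ring
            _ ≤ Real.sqrt k * (y * b) := by gcongr
            _ = b * (Real.sqrt k * y) := by ring
        exact h6.trans (by gcongr)
      have hexp : Real.exp (k * q) ≤ (1 + y) ^ b := by
        calc Real.exp (k * q) ≤ Real.exp (b * Real.log (1 + y)) := Real.exp_le_exp.2 hkq
          _ = (1 + y) ^ b := by
            rw [Real.exp_nat_mul, Real.exp_log (by linarith)]
      refine le_trans ?_ hexp
      set G := k * (γ / Real.exp 1) with hG
      have hGr : G ≤ k * q := by rw [hG]; gcongr
      have h8 := exp_mul_le_mul_exp hkg.le hGr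
      -- `e G ≤ k² e^G` and `e^G k q ≤ G e^(k q)` give `e q ≤ k e^(k q)`
      have hG0 : 0 < G := by linarith
      have h9 : Real.exp 1 * q ≤ k * Real.exp (k * q) := by
        have h10 : (Real.exp 1 * G) * (k * q) ≤ k ^ 2 * (G * Real.exp (k * q)) := by
          calc (Real.exp 1 * G) * (k * q) ≤ (k ^ 2 * Real.exp G) * (k * q) := by gcongr
            _ = k ^ 2 * (Real.exp G * (k * q)) := by ring
            _ ≤ _ := by gcongr
        have h11 : 0 < G * k := by positivity
        refine le_of_mul_le_mul_left ?_ h11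
        calc G * k * (Real.exp 1 * q) = (Real.exp 1 * G) * (k * q) := by ring
          _ ≤ _ := h10
          _ = G * k * (k * Real.exp (k * q)) := by ring
      calc a * (b * μ) = a * (Real.exp 1 * q) := by rw [hqe]; ring
        _ ≤ a * (k * Real.exp (k * q)) := by gcongr
        _ = (a * k) * Real.exp (k * q) := by ring
        _ ≤ 1 * Real.exp (k * q) := by gcongr
        _ = _ := one_mul _
  · have hμε : ε ^ p ≤ μ := by rw [hμ]; gcongr
    have hμle : μ ≤ 1 := by linarith
    constructor
    · rw [div_lt_iff₀ (by positivity)] at h2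
      calc a * Real.exp 1 ≤ K * Real.exp 1 := by gcongr
        _ < b * ε ^ p := h2
        _ ≤ b * μ := by gcongr
    · calc a * (b * μ) ≤ K * (b * 1) := by gcongr
        _ = K * b := by ring
        _ ≤ (1 + η) ^ b := h1
        _ ≤ _ := by rw [hη]; gcongr

lemma isClosed_fixedPts {f : ℝ → ℝ} (hf : ContinuousOn f (Set.Ici 0)) :
    IsClosed (fixedPts f) := by
  have : fixedPts f = Set.Ici 0 ∩ (fun x => f x - x) ⁻¹' {0} := by
    ext x; simp [fixedPts, sub_eq_zero]
  rw [this]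
  exact (hf.sub continuousOn_id).preimage_isClosed_of_isClosed isClosed_Ici isClosed_singleton

lemma exists_isLeast_fixedPts {f : ℝ → ℝ} (hf : ContinuousOn f (Set.Ici 0)) (h0 : 0 ≤ f 0)
    {x₀ : ℝ} (hx₀ : 0 ≤ x₀) (hfx : f x₀ ≤ x₀) : ∃ x ≤ x₀, IsLeast (fixedPts f) x := by
  have hcl := isClosed_fixedPts hf
  obtain ⟨x, hx, hxe⟩ : (0 : ℝ) ∈ (fun x => x - f x) '' Set.Icc 0 x₀ := by
    apply intermediate_value_Icc hx₀
    · exact continuousOn_id.sub (hf.mono fun x hx => hx.1)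
    · constructor <;> simp <;> assumption
  have hmem : x ∈ fixedPts f := ⟨hx.1, by simp only at hxe; linarith⟩
  have hbd : BddBelow (fixedPts f) := ⟨0, fun y hy => hy.1⟩
  exact ⟨sInf (fixedPts f), (csInf_le hbd hmem).trans hx.2, hcl.csInf_mem ⟨x, hmem⟩ hbd,
    fun y hy => csInf_le hbd hy⟩

lemma exists_isGreatest_fixedPts {f : ℝ → ℝ} (hf : ContinuousOn f (Set.Ici 0)) {y₀ M : ℝ}
    (hy₀ : 0 ≤ y₀) (hfy : y₀ ≤ f y₀) (hM : ∀ x, 0 ≤ x → f x ≤ M) :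
    ∃ y, y₀ ≤ y ∧ IsGreatest (fixedPts f) y := by
  have hcl := isClosed_fixedPts hf
  have hyM : y₀ ≤ M := hfy.trans (hM _ hy₀)
  obtain ⟨x, hx, hxe⟩ : (0 : ℝ) ∈ (fun x => x - f x) '' Set.Icc y₀ M := by
    apply intermediate_value_Icc hyM
    · exact continuousOn_id.sub (hf.mono fun x hx => hy₀.trans hx.1)
    · constructor
      · simpa using hfy
      · simpa using hM M (hy₀.trans hyM)
  have hmem : x ∈ fixedPts f := ⟨hy₀.trans hx.1, by simp only at hxe; linarith⟩
  have hbd : BddAbove (fixedPts f) := ⟨M, fun y hy => by rw [← hy.2]; exact hM y hy.1⟩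
  exact ⟨sSup (fixedPts f), hx.1.trans (le_csSup hbd hmem), hcl.csSup_mem ⟨x, hmem⟩ hbd,
    fun y hy => le_csSup hbd hy⟩

lemma continuousOn_J (b : ℕ) (lam : ℝ) : ContinuousOn (J b lam) (Set.Ici 0) := by
  unfold J
  refine ContinuousOn.div continuousOn_const (by fun_prop) fun x hx => ?_
  have : (0 : ℝ) ≤ x := hx
  positivity

lemma J_nonneg {b : ℕ} {lam x : ℝ} (hl : 0 ≤ lam) (hx : 0 ≤ x) : 0 ≤ J b lam x := by
  unfold J; positivity

lemma J_le {b : ℕ} {lam x : ℝ} (hl : 0 ≤ lam) (hx : 0 ≤ x) : J b lam x ≤ lam := by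
  unfold J
  exact div_le_self hl (one_le_pow₀ (by linarith))

lemma continuousOn_J₂ (b : ℕ) {lam : ℝ} (hl : 0 ≤ lam) :
    ContinuousOn (J₂ b lam) (Set.Ici 0) :=
  (continuousOn_J b lam).comp (continuousOn_J b lam) fun _ hx => J_nonneg hl hx

lemma extremal_fixedPts_of_trap {C b : ℕ} {lam x y : ℝ} (hl0 : 0 < lam) (hl1 : lam < 1)
    (hx : 0 < x) (hxy : x < y) (h1 : A lam * lam ^ jc C ≤ x * (1 + y) ^ b)
    (h2 : A lam * (y * (1 + x) ^ b) ≤ lam ^ jc C) :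
    ∃ x y : ℝ, IsLeast (fixedPts (upperMap b C lam)) x ∧
      IsGreatest (fixedPts (lowerMap b C lam)) y ∧ x < y := by
  have hA : 0 < A lam := by unfold A; rw [inv_pos]; linarith
  have hm : 0 < lamMinus C lam := by unfold lamMinus; positivity
  have hp : 0 < lamPlus C lam := by unfold lamPlus; positivity
  have hmp : A lam ^ 2 * lamMinus C lam = lamPlus C lam := by
    unfold lamMinus lamPlus; field_simp
  have hpm : (A lam ^ 2)⁻¹ * lamPlus C lam = lamMinus C lam := by
    rw [← hmp]; field_simp
  have hy : 0 < y := hx.trans hxy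
  have g1 : J b (lamPlus C lam) y ≤ x := by
    unfold J lamPlus; rw [div_le_iff₀ (by positivity)]; exact h1
  have g2 : y ≤ J b (lamMinus C lam) x := by
    unfold J lamMinus
    rw [le_div_iff₀ (by positivity), ← div_eq_inv_mul, le_div_iff₀ hA]
    linarith
  have hU : ∀ z, upperMap b C lam z = J b (lamPlus C lam) (J b (lamMinus C lam) z) := by
    intro z
    unfold upperMap J₂
    conv_lhs => rw [J]
    conv_rhs => rw [J]
    rw [← hmp]; ring
  have hL : ∀ z, lowerMap b C lam z = J b (lamMinus C lam) (J b (lamPlus C lam) z) := by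
    intro z
    unfold lowerMap J₂
    conv_lhs => rw [J]
    conv_rhs => rw [J]
    rw [← hpm]; ring
  have anti : ∀ {l u v : ℝ}, 0 ≤ l → 0 ≤ u → u ≤ v → J b l v ≤ J b l u := by
    intro l u v hl hu huv
    unfold J
    gcongr
  obtain ⟨x', hx', hl'⟩ := exists_isLeast_fixedPts (f := upperMap b C lam) (x₀ := x)
    (by unfold upperMap; exact continuousOn_const.mul (continuousOn_J₂ b hm.le))
    (by rw [hU]; exact J_nonneg hp.le (J_nonneg hm.le le_rfl)) hx.le
    (by rw [hU]; exact (anti hp.le hy.le g2).trans g1)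
  obtain ⟨y', hy', hg'⟩ := exists_isGreatest_fixedPts (f := lowerMap b C lam) (y₀ := y)
    (M := lamMinus C lam)
    (by unfold lowerMap; exact continuousOn_const.mul (continuousOn_J₂ b hp.le)) hy.le
    (by rw [hL]; exact g2.trans (anti hm.le (J_nonneg hp.le hy.le) g1))
    (fun z hz => by rw [hL]; exact J_le hm.le (J_nonneg hp.le hz))
  exact ⟨x', y', hl', hg', by linarith⟩

lemma pos_and_le_mul_pow_of_rpow_le {γ lam : ℝ} {b p : ℕ} (hγ : 0 < γ) (hb : 1 ≤ b)
    (hp : 1 ≤ p) (h : (γ / (b : ℝ)) ^ (1 / (p : ℝ)) ≤ lam) : 0 < lam ∧ γ ≤ b * lam ^ p := by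
  have hb0 : (0 : ℝ) < b := by exact_mod_cast hb
  have hpos : 0 < (γ / (b : ℝ)) ^ (1 / (p : ℝ)) := by positivity
  refine ⟨hpos.trans_le h, ?_⟩
  have h1 : ((γ / (b : ℝ)) ^ (1 / (p : ℝ))) ^ p ≤ lam ^ p := by gcongr
  rw [one_div, Real.rpow_inv_natCast_pow (by positivity) (by omega), div_le_iff₀ hb0] at h1
  linarith

lemma mul_pow_le_of_le_rpow {γ lam : ℝ} {b p : ℕ} (hγ : 0 < γ) (hb : 1 ≤ b)
    (hp : 1 ≤ p) (hl : 0 < lam) (h : lam ≤ (γ / (b : ℝ)) ^ (1 / (p : ℝ))) :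
    b * lam ^ p ≤ γ := by
  have hb0 : (0 : ℝ) < b := by exact_mod_cast hb
  have h1 : lam ^ p ≤ ((γ / (b : ℝ)) ^ (1 / (p : ℝ))) ^ p := by gcongr
  rw [one_div, Real.rpow_inv_natCast_pow (by positivity) (by omega), le_div_iff₀ hb0] at h1
  linarith

/-- This is where the parity of `C` enters. -/
lemma jc_spec {C : ℕ} (hC : Odd C) : C + 1 = 2 * jc C := by
  obtain ⟨k, rfl⟩ := hC
  have : jc (2 * k + 1) = k + 1 := by
    unfold jc
    rw [Nat.ceil_eq_iff (by omega)]
    push_cast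
    constructor <;> linarith
  omega

theorem exists_extremal_fixedPts {C : ℕ} (hC : Odd C) {γ : ℝ} (hγ : Real.exp 1 < γ)
    (lamBar : ℝ) (hl : lamBar < 1) : ∃ b₀ : ℕ, ∀ b : ℕ, b₀ ≤ b → ∀ lam : ℝ,
        (γ / (b : ℝ)) ^ (1 / (jc C : ℝ)) ≤ lam → lam ≤ lamBar →
          ∃ x y : ℝ, IsLeast (fixedPts (upperMap b C lam)) x ∧
            IsGreatest (fixedPts (lowerMap b C lam)) y ∧ x < y := by
  have hp : 1 ≤ jc C := by have := jc_spec hC; omega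
  obtain ⟨b₀, hb₀, H⟩ := exists_trap hγ (le_max_left 1 (1 - lamBar)⁻¹) hp
  refine ⟨b₀, fun b hb lam h1 h2 => ?_⟩
  obtain ⟨hl0, hm⟩ := pos_and_le_mul_pow_of_rpow_le ((Real.exp_pos 1).trans hγ) (hb₀.trans hb) hp h1
  have hl1 : lam < 1 := by linarith
  obtain ⟨x, y, hx, hxy, g1, g2⟩ := H b hb lam (A lam) hl0 hl1
    (by unfold A; rw [one_le_inv₀ (by linarith)]; linarith)
    (by
      refine le_trans ?_ (le_max_right _ _)
      unfold A
      rw [inv_le_inv₀ (by linarith) (by linarith)]; linarith) le_rfl hm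
  exact extremal_fixedPts_of_trap hl0 hl1 hx hxy g1 g2

/-! ### Sums over spins and consistency of the weights -/

section Spec
variable {V : Type*} {C : ℕ}

lemma glue_of_mem {U : Finset V} {ξ : U → Fin (C + 1)} {τ : V → Fin (C + 1)} {v : V}
    (h : v ∈ U) : glue U ξ τ v = ξ ⟨v, h⟩ := dif_pos h

lemma glue_of_notMem {U : Finset V} {ξ : U → Fin (C + 1)} {τ : V → Fin (C + 1)} {v : V}
    (h : v ∉ U) : glue U ξ τ v = τ v := dif_neg h

open Classical in
/-- The sum of `φ` over all spins in `U`, as a function of the spins off `U`. -/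
def siteSum (U : Finset V) (φ : (V → Fin (C + 1)) → ℝ) (σ : V → Fin (C + 1)) : ℝ :=
  ∑ ξ : U → Fin (C + 1), φ (glue U ξ σ)

lemma siteSum_congr {U : Finset V} {φ ψ : (V → Fin (C + 1)) → ℝ} {σ : V → Fin (C + 1)}
    (h : ∀ ξ : U → Fin (C + 1), φ (glue U ξ σ) = ψ (glue U ξ σ)) :
    siteSum U φ σ = siteSum U ψ σ := Finset.sum_congr rfl fun ξ _ => h ξ

lemma siteSum_nonneg {U : Finset V} {φ : (V → Fin (C + 1)) → ℝ} {σ : V → Fin (C + 1)}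
    (h : ∀ σ, 0 ≤ φ σ) : 0 ≤ siteSum U φ σ := Finset.sum_nonneg fun _ _ => h _

lemma siteSum_pos {U : Finset V} {φ : (V → Fin (C + 1)) → ℝ} {σ : V → Fin (C + 1)}
    (h : ∀ σ, 0 ≤ φ σ) (ξ : U → Fin (C + 1)) (hξ : 0 < φ (glue U ξ σ)) : 0 < siteSum U φ σ := by
  classical
  exact Finset.sum_pos' (fun _ _ => h _) ⟨ξ, Finset.mem_univ _, hξ⟩

lemma glue_zero (U : Finset V) :
    glue U (fun _ => (0 : Fin (C + 1))) (fun _ => 0) = fun _ => 0 := by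
  funext v; unfold glue; split_ifs <;> rfl

lemma siteSum_union {U U' W : Finset V} (h : Disjoint U U') (hW : ∀ v, v ∈ W ↔ v ∈ U ∨ v ∈ U')
    (φ : (V → Fin (C + 1)) → ℝ) (σ : V → Fin (C + 1)) :
    siteSum W φ σ = siteSum U (siteSum U' φ) σ := by
  classical
  obtain rfl : W = U ∪ U' := by ext v; rw [hW, Finset.mem_union]
  unfold siteSum
  rw [← Finset.sum_product' (f := fun ξ ξ' => φ (glue U' ξ' (glue U ξ σ))),
    Finset.univ_product_univ]
  symm
  refine Fintype.sum_equiv (Equiv.piFinsetUnion (fun _ : V => Fin (C + 1)) h) _ _ ?_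
  rintro ⟨ξ, ξ'⟩
  congr 1
  funext v
  by_cases h1 : v ∈ U
  · have h2 : v ∉ U' := Finset.disjoint_left.1 h h1
    rw [glue_of_notMem h2, glue_of_mem h1, glue_of_mem (Finset.mem_union_left _ h1)]
    exact (Equiv.piFinsetUnion_left (fun _ : V => Fin (C + 1)) h h1 _).symm
  · by_cases h2 : v ∈ U'
    · rw [glue_of_mem h2, glue_of_mem (Finset.mem_union_right _ h2)]
      exact (Equiv.piFinsetUnion_right (fun _ : V => Fin (C + 1)) h h2 _).symm
    · rw [glue_of_notMem h2, glue_of_notMem h1, glue_of_notMem (by simp [h1, h2])]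

/-- Functions of the spins off `U` come out of sums over the spins in `U`. -/
lemma siteSum_mul_right {U : Finset V} {f : (V → Fin (C + 1)) → ℝ}
    (hf : DependsOn f ((U : Set V)ᶜ)) (φ : (V → Fin (C + 1)) → ℝ) (σ : V → Fin (C + 1)) :
    siteSum U (fun σ => φ σ * f σ) σ = siteSum U φ σ * f σ := by
  unfold siteSum
  rw [Finset.sum_mul]
  refine Finset.sum_congr rfl fun ξ _ => ?_
  have : f (glue U ξ σ) = f σ := hf fun v hv => glue_of_notMem (by simpa using hv)
  simp only [this]

open Classical in
/-- The indicator of the event that the spins in `U` are `ξ`. -/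
def cyl (U : Finset V) (ξ : U → Fin (C + 1)) : (V → Fin (C + 1)) → ℝ :=
  Set.indicator {σ : V → Fin (C + 1) | ∀ v : U, σ v = ξ v} (fun _ => (1 : ℝ))

open Classical in
lemma cyl_apply (U : Finset V) (ξ : U → Fin (C + 1)) (σ : V → Fin (C + 1)) :
    cyl U ξ σ = if ∀ v : U, σ v = ξ v then 1 else 0 := by
  simp [cyl, Set.indicator_apply]

lemma dependsOn_cyl (U : Finset V) (ξ : U → Fin (C + 1)) : DependsOn (cyl U ξ) (U : Set V) := by
  intro σ σ' h
  rw [cyl_apply, cyl_apply]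
  congr 1
  simp only [eq_iff_iff]
  exact forall_congr' fun v => by rw [h v v.2]

lemma siteSum_mul_cyl (U : Finset V) (ξ : U → Fin (C + 1)) (φ : (V → Fin (C + 1)) → ℝ)
    (σ : V → Fin (C + 1)) :
    siteSum U (fun σ => φ σ * cyl U ξ σ) σ = φ (glue U ξ σ) := by
  classical
  unfold siteSum
  beta_reduce
  rw [Finset.sum_eq_single ξ]
  · rw [cyl_apply, if_pos, mul_one]
    exact fun v => glue_of_mem v.2
  · intro η _ hne
    rw [cyl_apply, if_neg, mul_zero]
    contrapose! hne
    funext v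
    rw [← hne v, glue_of_mem v.2]
  · simp

variable {G : SimpleGraph V} {lam : ℝ}

open Classical in
/-- The weight of the spins in `U`, as in `localWeight`, but as a function of a configuration `σ`
on all vertices. -/
def hullWeight (G : SimpleGraph V) (C : ℕ) (lam : ℝ) (U : Finset V) (σ : V → Fin (C + 1)) : ℝ :=
  if AllowedOn G C (closedHull G U) σ then ∏ v ∈ U, lam ^ (σ v : ℕ) else 0

lemma localWeight_eq (U : Finset V) (ξ : U → Fin (C + 1)) (τ : V → Fin (C + 1)) :
    localWeight G C lam U ξ τ = hullWeight G C lam U (glue U ξ τ) := by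
  unfold localWeight hullWeight
  congr 1
  rw [← Finset.prod_coe_sort U fun v => lam ^ (glue U ξ τ v : ℕ)]
  refine Finset.prod_congr rfl fun v _ => ?_
  rw [glue_of_mem v.2]

lemma condProb_eq (U : Finset V) (ξ : U → Fin (C + 1)) (τ : V → Fin (C + 1)) :
    condProb G C lam U ξ τ =
      hullWeight G C lam U (glue U ξ τ) / siteSum U (hullWeight G C lam U) τ := by
  unfold condProb siteSum
  simp only [localWeight_eq]

lemma hullWeight_nonneg (hl : 0 ≤ lam) (U : Finset V) (σ : V → Fin (C + 1)) :
    0 ≤ hullWeight G C lam U σ := by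
  unfold hullWeight
  split_ifs
  · positivity
  · exact le_rfl

lemma condProb_nonneg (hl : 0 ≤ lam) (U : Finset V) (ξ : U → Fin (C + 1))
    (τ : V → Fin (C + 1)) : 0 ≤ condProb G C lam U ξ τ := by
  rw [condProb_eq]
  exact div_nonneg (hullWeight_nonneg hl _ _) (siteSum_nonneg (hullWeight_nonneg hl _))

/-- The defining equation of `condProb`, without division. It holds also where the normalization
vanishes, as then all weights vanish. -/
lemma condProb_mul_siteSum (hl : 0 ≤ lam) (U : Finset V) (ξ : U → Fin (C + 1))
    (τ : V → Fin (C + 1)) : condProb G C lam U ξ τ * siteSum U (hullWeight G C lam U) τ =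
      hullWeight G C lam U (glue U ξ τ) := by
  classical
  rw [condProb_eq]
  refine div_mul_cancel_of_imp fun h => ?_
  exact (Finset.sum_eq_zero_iff_of_nonneg fun _ _ => hullWeight_nonneg hl _ _).1 h ξ
    (Finset.mem_univ _)

lemma siteSum_dependsOn {U : Finset V} {W : Set V} {φ : (V → Fin (C + 1)) → ℝ}
    (h : DependsOn φ W) : DependsOn (siteSum U φ) (W \ U) := by
  intro σ σ' hs
  refine Finset.sum_congr rfl fun ξ _ => h fun v hv => ?_
  by_cases hU : v ∈ U
  · rw [glue_of_mem hU, glue_of_mem hU]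
  · rw [glue_of_notMem hU, glue_of_notMem hU]
    exact hs v ⟨hv, hU⟩

lemma glue_comp_dependsOn {U : Finset V} {W : Set V} {φ : (V → Fin (C + 1)) → ℝ}
    (h : DependsOn φ W) (ξ : U → Fin (C + 1)) :
    DependsOn (fun τ => φ (glue U ξ τ)) (W \ U) := by
  intro σ σ' hs
  refine h fun v hv => ?_
  by_cases hU : v ∈ U
  · rw [glue_of_mem hU, glue_of_mem hU]
  · rw [glue_of_notMem hU, glue_of_notMem hU]
    exact hs v ⟨hv, hU⟩

lemma dependsOn_hullWeight (U : Finset V) :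
    DependsOn (hullWeight G C lam U) (closedHull G U) := by
  intro σ σ' h
  unfold hullWeight
  have h1 : AllowedOn G C (closedHull G U) σ ↔ AllowedOn G C (closedHull G U) σ' := by
    unfold AllowedOn
    refine forall₂_congr fun x hx => forall₂_congr fun y hy => ?_
    rw [h x hx, h y hy]
  have h2 : ∏ v ∈ U, lam ^ (σ v : ℕ) = ∏ v ∈ U, lam ^ (σ' v : ℕ) :=
    Finset.prod_congr rfl fun v hv => by rw [h v (Or.inl hv)]
  classical
  rw [h2]
  exact if_congr h1 rfl rfl

lemma dependsOn_condProb (U : Finset V) (ξ : U → Fin (C + 1)) :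
    DependsOn (condProb G C lam U ξ) (boundary G U) := by
  have hsub : closedHull G U \ U ⊆ boundary G U := by
    rintro v ⟨h1 | h1, h2⟩
    · exact absurd h1 h2
    · exact h1
  intro σ σ' h
  rw [condProb_eq, condProb_eq]
  congr 1
  · exact glue_comp_dependsOn (dependsOn_hullWeight U) ξ fun v hv => h v (hsub hv)
  · exact siteSum_dependsOn (dependsOn_hullWeight U) fun v hv => h v (hsub hv)

lemma boundary_subset_compl (U : Finset V) : boundary G U ⊆ (U : Set V)ᶜ := fun _ h => h.1

/-- The weights are consistent: enlarging `U` multiplies the weight by a function of the spins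
off `U`. -/
lemma exists_hullWeight_eq_mul {U B : Finset V} (hUB : U ⊆ B) :
    ∃ R : (V → Fin (C + 1)) → ℝ, DependsOn R ((U : Set V)ᶜ) ∧
      ∀ σ, hullWeight G C lam B σ = hullWeight G C lam U σ * R σ := by
  classical
  have hhull : closedHull G U ⊆ closedHull G B := by
    rintro x (hx | ⟨hx, z, hz, hxz⟩)
    · exact Or.inl (hUB hx)
    · by_cases hxB : x ∈ B
      · exact Or.inl hxB
      · exact Or.inr ⟨hxB, z, hUB hz, hxz⟩
  let P : (V → Fin (C + 1)) → Prop := fun σ => ∀ x ∈ closedHull G B, ∀ y ∈ closedHull G B,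
    G.Adj x y → ¬ (x ∈ closedHull G U ∧ y ∈ closedHull G U) → (σ x : ℕ) + (σ y : ℕ) ≤ C
  have hall : ∀ σ, AllowedOn G C (closedHull G B) σ ↔
      AllowedOn G C (closedHull G U) σ ∧ P σ := by
    intro σ
    constructor
    · exact fun h => ⟨fun x hx y hy => h x (hhull hx) y (hhull hy),
        fun x hx y hy hxy _ => h x hx y hy hxy⟩
    · rintro ⟨h1, h2⟩ x hx y hy hxy
      by_cases hh : x ∈ closedHull G U ∧ y ∈ closedHull G U
      · exact h1 x hh.1 y hh.2 hxy
      · exact h2 x hx y hy hxy hh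
  have hadj : ∀ x y, G.Adj x y → x ∈ U → x ∈ closedHull G U ∧ y ∈ closedHull G U := by
    intro x y hxy hx
    refine ⟨Or.inl hx, ?_⟩
    by_cases hy : y ∈ U
    · exact Or.inl hy
    · exact Or.inr ⟨hy, x, hx, hxy.symm⟩
  refine ⟨fun σ => if P σ then ∏ v ∈ B \ U, lam ^ (σ v : ℕ) else 0, ?_, ?_⟩
  · intro σ σ' h
    have h1 : P σ ↔ P σ' := by
      refine forall₂_congr fun x _ => forall₂_congr fun y _ => forall₂_congr fun hxy hn => ?_
      have hx : x ∉ U := fun hx => hn (hadj x y hxy hx)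
      have hy : y ∉ U := fun hy => hn (hadj y x hxy.symm hy).symm
      rw [h x (by simpa using hx), h y (by simpa using hy)]
    have h2 : ∏ v ∈ B \ U, lam ^ (σ v : ℕ) = ∏ v ∈ B \ U, lam ^ (σ' v : ℕ) :=
      Finset.prod_congr rfl fun v hv => by
        rw [h v (by simpa using (Finset.mem_sdiff.1 hv).2)]
    beta_reduce
    rw [h2]
    exact if_congr h1 rfl rfl
  · intro σ
    unfold hullWeight
    simp only [hall σ]
    by_cases h1 : AllowedOn G C (closedHull G U) σ <;> by_cases h2 : P σ <;> simp [h1, h2]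
    rw [mul_comm, Finset.prod_sdiff hUB]

/-- The finite-volume form of the DLR equation. -/
lemma siteSum_hullWeight_mul_cyl (hl : 0 ≤ lam) {U B : Finset V} (hUB : U ⊆ B)
    {f : (V → Fin (C + 1)) → ℝ} (hf : DependsOn f ((U : Set V)ᶜ)) (ξ : U → Fin (C + 1))
    (τ : V → Fin (C + 1)) :
    siteSum B (fun σ => hullWeight G C lam B σ * (f σ * cyl U ξ σ)) τ =
      siteSum B (fun σ => hullWeight G C lam B σ * (f σ * condProb G C lam U ξ σ)) τ := by
  classical
  obtain ⟨R, hR, hBR⟩ := exists_hullWeight_eq_mul (G := G) (C := C) (lam := lam) hUB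
  have hc : DependsOn (condProb G C lam U ξ) ((U : Set V)ᶜ) := fun σ σ' h =>
    dependsOn_condProb U ξ fun v hv => h v (boundary_subset_compl U hv)
  have hW : ∀ v, v ∈ B ↔ v ∈ B \ U ∨ v ∈ U := fun v => by
    rw [← Finset.mem_union, Finset.sdiff_union_of_subset hUB]
  rw [siteSum_union Finset.sdiff_disjoint hW, siteSum_union Finset.sdiff_disjoint hW]
  refine siteSum_congr fun η => ?_
  generalize glue (B \ U) η τ = σ
  have e1 : (fun σ => hullWeight G C lam B σ * (f σ * cyl U ξ σ)) =
      fun σ => (hullWeight G C lam U σ * cyl U ξ σ) * (R σ * f σ) := by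
    funext σ; rw [hBR]; ring
  have e2 : (fun σ => hullWeight G C lam B σ * (f σ * condProb G C lam U ξ σ)) =
      fun σ => hullWeight G C lam U σ * (condProb G C lam U ξ σ * (R σ * f σ)) := by
    funext σ; rw [hBR]; ring
  have d1 : DependsOn (fun σ => R σ * f σ) ((U : Set V)ᶜ) := fun σ σ' h => by
    simp only [hR h, hf h]
  have d2 : DependsOn (fun σ => condProb G C lam U ξ σ * (R σ * f σ)) ((U : Set V)ᶜ) :=
    fun σ σ' h => by simp only [hR h, hf h, hc h]
  rw [e1, e2, siteSum_mul_right d1, siteSum_mul_right d2, siteSum_mul_cyl,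
    ← condProb_mul_siteSum hl]
  ring

/-! ### Finite-volume measures and their limits -/

open Classical in
/-- The finite-volume measure on `B` with boundary condition `τ`. -/
def finVol (G : SimpleGraph V) (C : ℕ) (lam : ℝ) (B : Finset V) (τ : V → Fin (C + 1)) :
    Measure (V → Fin (C + 1)) :=
  ∑ ξ : B → Fin (C + 1), ENNReal.ofReal (condProb G C lam B ξ τ) • Measure.dirac (glue B ξ τ)

lemma siteSum_hullWeight_zero_pos (hl : 0 < lam) (B : Finset V) :
    0 < siteSum B (hullWeight G C lam B) (fun _ => 0) := by
  refine siteSum_pos (hullWeight_nonneg hl.le B) (fun _ => 0) ?_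
  rw [glue_zero, hullWeight, if_pos]
  · positivity
  · intro x _ y _ _; simp

lemma isProbabilityMeasure_finVol (hl : 0 ≤ lam) {B : Finset V} {τ : V → Fin (C + 1)}
    (h : 0 < siteSum B (hullWeight G C lam B) τ) :
    IsProbabilityMeasure (finVol G C lam B τ) := by
  constructor
  simp only [finVol, Measure.coe_finsetSum, Finset.sum_apply, Measure.smul_apply, measure_univ,
    smul_eq_mul, mul_one]
  rw [← ENNReal.ofReal_sum_of_nonneg fun _ _ => condProb_nonneg hl _ _ _]
  simp only [condProb_eq]
  rw [← Finset.sum_div]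
  change ENNReal.ofReal (siteSum B (hullWeight G C lam B) τ / _) = 1
  rw [div_self h.ne', ENNReal.ofReal_one]

lemma integral_finVol [Countable V] (hl : 0 ≤ lam) (B : Finset V) (τ : V → Fin (C + 1))
    (f : (V → Fin (C + 1)) → ℝ) : ∫ σ, f σ ∂finVol G C lam B τ =
      siteSum B (fun σ => hullWeight G C lam B σ * f σ) τ /
        siteSum B (hullWeight G C lam B) τ := by
  unfold finVol
  rw [integral_finsetSum_measure]
  · rw [siteSum, Finset.sum_div]
    refine Finset.sum_congr rfl fun ξ _ => ?_
    rw [integral_smul_measure, integral_dirac, ENNReal.toReal_ofReal (condProb_nonneg hl _ _ _),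
      condProb_eq, smul_eq_mul]
    ring
  · intro ξ _
    refine Integrable.smul_measure ?_ ENNReal.ofReal_ne_top
    exact integrable_dirac (by simp)

lemma continuous_of_dependsOn {W : Finset V} {f : (V → Fin (C + 1)) → ℝ}
    (h : DependsOn f (W : Set V)) : Continuous f := by
  have : f = (fun η : W → Fin (C + 1) => f (glue W η fun _ => 0)) ∘ fun σ v => σ v := by
    funext σ
    refine h fun v hv => ?_
    rw [glue_of_mem (by simpa using hv)]
  rw [this]
  exact continuous_of_discreteTopology.comp (by fun_prop)

lemma measurable_of_dependsOn {W : Finset V} {Δ : Set V} (hW : (W : Set V) ⊆ Δ)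
    {f : (V → Fin (C + 1)) → ℝ} (h : DependsOn f (W : Set V)) :
    Measurable[cylinderEvents Δ] f := by
  have : f = (fun η : W → Fin (C + 1) => f (glue W η fun _ => 0)) ∘ fun σ v => σ v := by
    funext σ
    refine h fun v hv => ?_
    rw [glue_of_mem (by simpa using hv)]
  rw [this]
  refine Measurable.comp (measurable_of_countable _) ?_
  exact @measurable_pi_lambda _ _ _ (cylinderEvents Δ) _ _
    fun v => measurable_cylinderEvent_apply (hW v.2)

lemma integrable_of_dependsOn {μ : Measure (V → Fin (C + 1))} [IsFiniteMeasure μ] {W : Finset V}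
    {f : (V → Fin (C + 1)) → ℝ} (h : DependsOn f (W : Set V)) : Integrable f μ := by
  have hm : Measurable f :=
    (measurable_of_dependsOn (Set.subset_univ _) h).mono cylinderEvents_le_pi le_rfl
  obtain ⟨M, hM⟩ : ∃ M, ∀ σ, ‖f σ‖ ≤ M := by
    obtain ⟨M, hM⟩ := (isCompact_range (continuous_of_dependsOn h)).isBounded.exists_norm_le
    exact ⟨M, fun σ => hM _ ⟨σ, rfl⟩⟩
  exact Integrable.of_bound hm.aestronglyMeasurable M (Filter.Eventually.of_forall hM)

lemma dependsOn_indicator {U : Set V} {s : Set (V → Fin (C + 1))} (hs : DependsOn (· ∈ s) U) :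
    DependsOn (s.indicator fun _ => (1 : ℝ)) U := by
  classical
  intro σ σ' h
  have h' : σ ∈ s ↔ σ' ∈ s := by simpa using hs h
  simp only [Set.indicator_apply]
  exact if_congr h' rfl rfl

/-- It is enough to check the DLR equations against cylinder events. -/
lemma isGibbs_of_forall_cylinder [Countable V] (hfin : ∀ U : Finset V, (boundary G U).Finite)
    {μ : Measure (V → Fin (C + 1))} [IsProbabilityMeasure μ]
    (h : ∀ (U W : Finset V) (ξ : U → Fin (C + 1)) (f : (V → Fin (C + 1)) → ℝ),
      Disjoint (U : Set V) W → DependsOn f (W : Set V) →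
      ∫ σ, f σ * cyl U ξ σ ∂μ = ∫ σ, f σ * condProb G C lam U ξ σ ∂μ) :
    IsGibbs G C lam μ := by
  refine ⟨inferInstance, fun U ξ => ?_⟩
  have hm : cylinderEvents ((U : Set V)ᶜ) ≤ (MeasurableSpace.pi : MeasurableSpace (V → Fin (C + 1))) :=
    cylinderEvents_le_pi
  have hdep : DependsOn (condProb G C lam U ξ) ((hfin U).toFinset : Set V) := by
    rw [Set.Finite.coe_toFinset]; exact dependsOn_condProb U ξ
  have hmeas : Measurable[cylinderEvents ((U : Set V)ᶜ)] (condProb G C lam U ξ) := by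
    refine measurable_of_dependsOn ?_ hdep
    rw [Set.Finite.coe_toFinset]; exact boundary_subset_compl U
  have hint1 : Integrable (cyl U ξ) μ := integrable_of_dependsOn (dependsOn_cyl U ξ)
  have hint2 : Integrable (condProb G C lam U ξ) μ := integrable_of_dependsOn hdep
  symm
  refine ae_eq_condExp_of_forall_setIntegral_eq hm hint1 (fun _ _ _ => hint2.integrableOn) ?_
    hmeas.aestronglyMeasurable
  intro s hs _
  have huniv : ∫ σ, condProb G C lam U ξ σ ∂μ = ∫ σ, cyl U ξ σ ∂μ := by
    simpa using (h U ∅ ξ (fun _ => 1) (by simp) (fun _ _ _ => rfl)).symm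
  refine MeasurableSpace.induction_on_inter
    (C := fun s _ => ∫ σ in s, condProb G C lam U ξ σ ∂μ = ∫ σ in s, cyl U ξ σ ∂μ)
    (generateFrom_piiUnionInter_measurableSet
      (fun v => (inferInstance : MeasurableSpace (Fin (C + 1))).comap fun σ : V → Fin (C + 1) => σ v)
      ((U : Set V)ᶜ)).symm
    (isPiSystem_piiUnionInter _ (fun v => @MeasurableSpace.isPiSystem_measurableSet _
      ((inferInstance : MeasurableSpace (Fin (C + 1))).comap fun σ : V → Fin (C + 1) => σ v)) _)
    (by simp) ?_ ?_ ?_ s hs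
  · rintro t ⟨W, hW, g, hg, rfl⟩
    have hdep' : DependsOn (fun σ : V → Fin (C + 1) => σ ∈ ⋂ v ∈ W, g v) (W : Set V) := by
      intro σ σ' hσ
      simp only [Set.mem_iInter, eq_iff_iff]
      refine forall₂_congr fun v hv => ?_
      obtain ⟨r, -, hr⟩ := hg v hv
      rw [← hr, Set.mem_preimage, Set.mem_preimage, hσ v hv]
    have htm : MeasurableSet (⋂ v ∈ W, g v) :=
      Finset.measurableSet_biInter _ fun v hv => by
        obtain ⟨r, hr, hr'⟩ := hg v hv
        have hmv : Measurable fun σ : V → Fin (C + 1) => σ v := measurable_pi_apply v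
        have := hmv hr
        rwa [hr'] at this
    have := h U W ξ ((⋂ v ∈ W, g v).indicator fun _ => (1 : ℝ))
      (Set.disjoint_left.2 fun v hv hv' => hW hv' hv) (dependsOn_indicator hdep')
    rw [← integral_indicator htm, ← integral_indicator htm]
    convert this.symm using 2 <;>
    · funext σ
      by_cases hσ : σ ∈ ⋂ v ∈ W, g v
      · rw [Set.indicator_of_mem hσ, Set.indicator_of_mem hσ, one_mul]
      · rw [Set.indicator_of_notMem hσ, Set.indicator_of_notMem hσ, zero_mul]
  · intro t ht hte
    rw [setIntegral_compl (hm _ ht) hint2, setIntegral_compl (hm _ ht) hint1, hte, huniv]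
  · intro t hd ht hte
    rw [integral_iUnion (fun i => hm _ (ht i)) hd hint2.integrableOn,
      integral_iUnion (fun i => hm _ (ht i)) hd hint1.integrableOn]
    exact tsum_congr hte

/-- Finite-volume measures on an exhaustion have limit points, along any ultrafilter, and these
are Gibbs measures. -/
theorem exists_isGibbs_tendsto [Countable V] (hl : 0 < lam)
    (hfin : ∀ U : Finset V, (boundary G U).Finite) (B : ℕ → Finset V)
    (hB : ∀ U : Finset V, ∀ᶠ n in Filter.atTop, U ⊆ B n) (l : Ultrafilter ℕ)
    (hl' : (l : Filter ℕ) ≤ Filter.atTop) :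
    ∃ μ : Measure (V → Fin (C + 1)), IsGibbs G C lam μ ∧
      ∀ (W : Finset V) (f : (V → Fin (C + 1)) → ℝ), DependsOn f (W : Set V) →
        Filter.Tendsto (fun n => siteSum (B n) (fun σ => hullWeight G C lam (B n) σ * f σ)
          (fun _ => 0) / siteSum (B n) (hullWeight G C lam (B n)) (fun _ => 0)) l
          (nhds (∫ σ, f σ ∂μ)) := by
  let ν : ℕ → ProbabilityMeasure (V → Fin (C + 1)) := fun n =>
    ⟨finVol G C lam (B n) fun _ => 0,
      isProbabilityMeasure_finVol hl.le (siteSum_hullWeight_zero_pos hl (B n))⟩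
  obtain ⟨μ, -, hμ⟩ := isCompact_univ.ultrafilter_le_nhds (l.map ν) (by simp)
  have key : ∀ (W : Finset V) (f : (V → Fin (C + 1)) → ℝ), DependsOn f (W : Set V) →
        Filter.Tendsto (fun n => siteSum (B n) (fun σ => hullWeight G C lam (B n) σ * f σ)
          (fun _ => 0) / siteSum (B n) (hullWeight G C lam (B n)) (fun _ => 0)) l
          (nhds (∫ σ, f σ ∂(μ : Measure (V → Fin (C + 1))))) := by
    intro W f hf
    have := (ProbabilityMeasure.tendsto_iff_forall_integral_tendsto.1
      (show Filter.Tendsto ν l (nhds μ) from hμ))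
      (BoundedContinuousFunction.mkOfCompact ⟨f, continuous_of_dependsOn hf⟩)
    simpa [ν, integral_finVol hl.le] using this
  refine ⟨μ, isGibbs_of_forall_cylinder hfin fun U W ξ f hUW hf => ?_, key⟩
  classical
  have d1 : DependsOn (fun σ => f σ * cyl U ξ σ) ((W ∪ U : Finset V) : Set V) := by
    intro σ σ' h
    have h1 := hf fun v hv => h v (by simp [Finset.mem_coe.1 hv])
    have h2 := dependsOn_cyl U ξ fun v hv => h v (by simp [Finset.mem_coe.1 hv])
    simp only [h1, h2]
  have d2 : DependsOn (fun σ => f σ * condProb G C lam U ξ σ)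
      ((W ∪ (hfin U).toFinset : Finset V) : Set V) := by
    intro σ σ' h
    have h1 := hf fun v hv => h v (by simp [Finset.mem_coe.1 hv])
    have h2 := dependsOn_condProb (G := G) (lam := lam) U ξ fun v hv => h v (by simp [hv])
    simp only [h1, h2]
  refine tendsto_nhds_unique_of_eventuallyEq (key _ _ d1) (key _ _ d2) ?_
  filter_upwards [hl' (hB U)] with n hn
  have hf' : DependsOn f ((U : Set V)ᶜ) := fun σ σ' h =>
    hf fun v hv => h v fun hv' => Set.disjoint_left.1 hUW hv' hv
  rw [siteSum_hullWeight_mul_cyl hl.le hn hf' ξ]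

/-- A Gibbs measure integrates finite-volume expectations. -/
lemma IsGibbs.integral_eq [Countable V]
    (hfin : ∀ U : Finset V, (boundary G U).Finite) {μ : Measure (V → Fin (C + 1))}
    (hμ : IsGibbs G C lam μ) (B : Finset V) {f : (V → Fin (C + 1)) → ℝ}
    (hf : DependsOn f (B : Set V)) :
    ∫ σ, f σ ∂μ = ∫ τ, siteSum B (fun σ => hullWeight G C lam B σ * f σ) τ /
        siteSum B (hullWeight G C lam B) τ ∂μ := by
  classical
  have := hμ.isProbabilityMeasure
  have hdep : ∀ ξ, DependsOn (condProb G C lam B ξ) ((hfin B).toFinset : Set V) := fun ξ => by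
    rw [Set.Finite.coe_toFinset]; exact dependsOn_condProb B ξ
  have hcyl : ∀ ξ, ∫ σ, cyl B ξ σ ∂μ = ∫ τ, condProb G C lam B ξ τ ∂μ := fun ξ => by
    rw [← integral_congr_ae (hμ.condExp_eq B ξ)]
    exact (integral_condExp cylinderEvents_le_pi).symm
  have e1 : ∀ σ, f σ = ∑ ξ : B → Fin (C + 1), f (glue B ξ fun _ => 0) * cyl B ξ σ := by
    intro σ
    rw [Finset.sum_eq_single (fun v : B => σ v)]
    · rw [cyl_apply, if_pos fun _ => rfl, mul_one]
      refine congrArg f ?_ |>.trans (hf fun v hv => (glue_of_mem (U := B)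
        (ξ := fun v : B => σ v) (τ := fun _ => 0) (Finset.mem_coe.1 hv)).symm)
      rfl
    · intro ξ _ hne
      rw [cyl_apply, if_neg, mul_zero]
      contrapose! hne
      funext v; exact (hne v).symm
    · simp
  have e2 : ∀ τ, siteSum B (fun σ => hullWeight G C lam B σ * f σ) τ /
        siteSum B (hullWeight G C lam B) τ =
      ∑ ξ : B → Fin (C + 1), f (glue B ξ fun _ => 0) * condProb G C lam B ξ τ := by
    intro τ
    rw [siteSum, Finset.sum_div]
    refine Finset.sum_congr rfl fun ξ _ => ?_
    rw [condProb_eq]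
    have : f (glue B ξ τ) = f (glue B ξ fun _ => 0) := hf fun v hv => by
      rw [glue_of_mem (by simpa using hv), glue_of_mem (by simpa using hv)]
    rw [this]; ring
  simp_rw [e2]
  rw [integral_finsetSum _ fun ξ _ => (integrable_of_dependsOn (hdep ξ)).const_mul _]
  conv_lhs => enter [2, σ]; rw [e1 σ]
  rw [integral_finsetSum _ fun ξ _ => (integrable_of_dependsOn (dependsOn_cyl B ξ)).const_mul _]
  refine Finset.sum_congr rfl fun ξ _ => ?_
  rw [integral_const_mul, integral_const_mul, hcyl]

/-- Probability measures on configurations are determined by finite-volume marginals. -/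
lemma measure_eq_of_forall_cyl {μ ν : Measure (V → Fin (C + 1))} [IsProbabilityMeasure μ]
    [IsProbabilityMeasure ν] (B : ℕ → Finset V) (hB : ∀ U : Finset V, ∃ n, U ⊆ B n)
    (h : ∀ n (ξ : B n → Fin (C + 1)), ∫ σ, cyl (B n) ξ σ ∂μ = ∫ σ, cyl (B n) ξ σ ∂ν) :
    μ = ν := by
  classical
  have hB' : ∀ n, μ.map (B n).restrict = ν.map (B n).restrict := by
    intro n
    refine Measure.ext_of_singleton fun ξ => ?_
    have hms : MeasurableSet {σ : V → Fin (C + 1) | ∀ v : B n, σ v = ξ v} := by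
      rw [Set.ofPred_forall]
      exact MeasurableSet.iInter fun v => measurable_pi_apply _ (measurableSet_singleton _)
    have := h n ξ
    rw [cyl, integral_indicator_const _ hms, integral_indicator_const _ hms] at this
    simp only [smul_eq_mul, mul_one] at this
    rw [measureReal_eq_measureReal_iff] at this
    rw [Measure.map_apply (Finset.measurable_restrict _) (measurableSet_singleton _),
      Measure.map_apply (Finset.measurable_restrict _) (measurableSet_singleton _)]
    convert this using 2 <;> (ext σ; simp [funext_iff])
  refine IsProjectiveLimit.unique (P := fun U : Finset V => ν.map U.restrict) ?_ fun U => rfl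
  intro U
  obtain ⟨n, hn⟩ := hB U
  have hr : U.restrict (π := fun _ : V => Fin (C + 1)) =
      Finset.restrict₂ hn ∘ (B n).restrict := rfl
  beta_reduce
  rw [hr, ← Measure.map_map (Finset.measurable_restrict₂ hn) (Finset.measurable_restrict _),
    ← Measure.map_map (Finset.measurable_restrict₂ hn) (Finset.measurable_restrict _), hB']

end Spec

/-! ### Summing out the levels of the tree -/

section Tree
variable {b C : ℕ} {lam : ℝ}

/-- The vertices at distance `n` from the root. -/
def level (b n : ℕ) : Finset (List (Fin b)) := (List.finite_length_eq (Fin b) n).toFinset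

/-- The vertices at distance less than `n` from the root. -/
def ball (b n : ℕ) : Finset (List (Fin b)) := (List.finite_length_lt (Fin b) n).toFinset

@[simp] lemma mem_level {n : ℕ} {v : List (Fin b)} : v ∈ level b n ↔ v.length = n := by
  simp [level]

@[simp] lemma mem_ball {n : ℕ} {v : List (Fin b)} : v ∈ ball b n ↔ v.length < n := by
  simp [ball]

lemma disjoint_ball_level (n : ℕ) : Disjoint (ball b n) (level b n) := by
  rw [Finset.disjoint_left]
  intro v h1 h2
  rw [mem_ball] at h1; rw [mem_level] at h2; omega

lemma mem_ball_succ {n : ℕ} (v : List (Fin b)) :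
    v ∈ ball b (n + 1) ↔ v ∈ ball b n ∨ v ∈ level b n := by
  simp; omega

lemma exists_subset_ball (U : Finset (List (Fin b))) : ∃ n, U ⊆ ball b n := by
  refine ⟨U.sup List.length + 1, fun v hv => ?_⟩
  rw [mem_ball]
  exact Nat.lt_succ_of_le (Finset.le_sup (f := List.length) hv)

lemma ball_mono {m n : ℕ} (h : m ≤ n) : ball b m ⊆ ball b n := fun v hv => by
  rw [mem_ball] at *; omega

lemma finite_boundary_tree (U : Finset (List (Fin b))) : (boundary (tree b) U).Finite := by
  refine ((U : Set (List (Fin b))).toFinite.image List.tail |>.union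
    ((Set.toFinite (Set.univ : Set (Fin b))).image2 List.cons U.finite_toSet)).subset ?_
  rintro x ⟨-, z, hz, ⟨i, rfl⟩ | ⟨i, rfl⟩⟩
  · exact Or.inr ⟨i, Set.mem_univ _, z, hz, rfl⟩
  · exact Or.inl ⟨i :: x, hz, rfl⟩

lemma level_zero : level b 0 = {[]} := by
  ext v; simp

lemma prod_ball_succ (n : ℕ) (f : List (Fin b) → ℝ) :
    ∏ v ∈ ball b (n + 1), f v = (∏ v ∈ ball b n, f v) * ∏ v ∈ level b n, f v := by
  rw [← Finset.prod_union (disjoint_ball_level n)]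
  refine Finset.prod_congr ?_ fun _ _ => rfl
  ext v; rw [mem_ball_succ, Finset.mem_union]

lemma prod_level_succ (n : ℕ) (f : List (Fin b) → ℝ) :
    ∏ v ∈ level b (n + 1), f v = ∏ v ∈ level b n, ∏ c : Fin b, f (c :: v) := by
  rw [← Finset.prod_product']
  symm
  refine Finset.prod_bij (fun x _ => x.2 :: x.1) ?_ ?_ ?_ fun _ _ => rfl
  · rintro ⟨v, c⟩ h
    simpa using h
  · rintro ⟨v, c⟩ _ ⟨w, d⟩ _ h
    simp only [List.cons.injEq] at h
    simp [h.1, h.2]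
  · intro w hw
    match w, hw with
    | [], hw => simp at hw
    | c :: v, hw => exact ⟨(v, c), by simpa using hw, rfl⟩

/-- The hard constraint between neighbouring spins `i` and `j`. -/
def compat (C i j : ℕ) : ℝ := if i + j ≤ C then 1 else 0

/-- The activity at `v` together with the hard constraints between `v` and its children. -/
def vertexWeight (lam : ℝ) (σ : List (Fin b) → Fin (C + 1)) (v : List (Fin b)) : ℝ :=
  lam ^ (σ v : ℕ) * ∏ c : Fin b, compat C (σ v) (σ (c :: v))

/-- The weight of a configuration on the first `n + 1` levels, the activities of the last level
being left out. -/
def ballWeight (lam : ℝ) (n : ℕ) (σ : List (Fin b) → Fin (C + 1)) : ℝ :=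
  ∏ v ∈ ball b n, vertexWeight lam σ v

lemma allowedOn_ball_iff {n : ℕ} {σ : List (Fin b) → Fin (C + 1)} :
    AllowedOn (tree b) C (closedHull (tree b) (ball b n)) σ ↔
      ∀ v ∈ ball b n, ∀ c : Fin b, (σ v : ℕ) + (σ (c :: v) : ℕ) ≤ C := by
  constructor
  · intro h v hv c
    refine h v (Or.inl hv) (c :: v) ?_ (Or.inr ⟨c, rfl⟩)
    by_cases hc : c :: v ∈ ball b n
    · exact Or.inl hc
    · exact Or.inr ⟨hc, v, hv, Or.inl ⟨c, rfl⟩⟩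
  · intro h
    have hlen : ∀ x ∈ closedHull (tree b) (ball b n), x.length ≤ n := by
      rintro x (hx | ⟨-, z, hz, ⟨i, rfl⟩ | ⟨i, rfl⟩⟩)
      · exact (mem_ball.1 hx).le
      · have := mem_ball.1 hz; simp; omega
      · have := mem_ball.1 hz; simp at this; omega
    have key : ∀ (v : List (Fin b)) (c : Fin b), c :: v ∈ closedHull (tree b) (ball b n) →
        (σ v : ℕ) + (σ (c :: v) : ℕ) ≤ C := fun v c hc => by
      refine h v ?_ c
      have := hlen _ hc
      rw [mem_ball]; simp at this; omega
    rintro x hx y hy (⟨i, rfl⟩ | ⟨i, rfl⟩)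
    · rw [add_comm]; exact key _ _ hx
    · exact key _ _ hy

lemma hullWeight_ball (n : ℕ) (σ : List (Fin b) → Fin (C + 1)) :
    hullWeight (tree b) C lam (ball b n) σ = ballWeight lam n σ := by
  classical
  unfold hullWeight ballWeight vertexWeight
  rw [Finset.prod_mul_distrib]
  by_cases h : AllowedOn (tree b) C (closedHull (tree b) (ball b n)) σ
  · rw [if_pos h, Finset.prod_eq_one (s := ball b n)
      (f := fun v => ∏ c : Fin b, compat C (σ v) (σ (c :: v))), mul_one]
    intro v hv
    refine Finset.prod_eq_one fun c _ => ?_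
    rw [compat, if_pos (allowedOn_ball_iff.1 h v hv c)]
  · rw [if_neg h]
    rw [allowedOn_ball_iff] at h
    push Not at h
    obtain ⟨v, hv, c, hc⟩ := h
    rw [Finset.prod_eq_zero (s := ball b n)
      (f := fun v => ∏ c : Fin b, compat C (σ v) (σ (c :: v))) hv, mul_zero]
    refine Finset.prod_eq_zero (Finset.mem_univ c) ?_
    rw [compat, if_neg (by omega)]

lemma dependsOn_ballWeight (n : ℕ) :
    DependsOn (ballWeight (b := b) (C := C) lam n) (ball b (n + 1) : Set (List (Fin b))) := by
  intro σ σ' h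
  refine Finset.prod_congr rfl fun v hv => ?_
  have hv' := mem_ball.1 hv
  have h0 : σ v = σ' v := h v (by simp; omega)
  unfold vertexWeight
  rw [h0]
  congr 1
  refine Finset.prod_congr rfl fun c _ => ?_
  rw [h (c :: v) (by simp; omega)]

/-- One level of the recursion for weights of subtrees: from the weights `W v i` of the subtrees
at `v` with spin `i` at their root, to those of the trees one level higher. -/
def subtreeStep (C : ℕ) (lam : ℝ) (W : List (Fin b) → ℕ → ℝ) (v : List (Fin b)) (i : ℕ) : ℝ :=
  lam ^ i * ∏ c : Fin b, ∑ j ∈ Finset.range (C - i + 1), W (c :: v) j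

/-- The boundary condition `τ` as a family of weights. -/
def pinned (τ : List (Fin b) → Fin (C + 1)) (v : List (Fin b)) (i : ℕ) : ℝ :=
  if i = τ v then 1 else 0

lemma sum_compat_mul {i : ℕ} (hi : i ≤ C) (w : ℕ → ℝ) :
    ∑ j : Fin (C + 1), compat C i j * w j = ∑ j ∈ Finset.range (C - i + 1), w j := by
  rw [Fin.sum_univ_eq_sum_range (fun j => compat C i j * w j) (C + 1)]
  have : Finset.range (C - i + 1) = (Finset.range (C + 1)).filter fun j => i + j ≤ C := by
    ext j; simp; omega
  rw [this, Finset.sum_filter]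
  refine Finset.sum_congr rfl fun j _ => ?_
  unfold compat
  split_ifs <;> simp

lemma subtreeStep_pinned (τ : List (Fin b) → Fin (C + 1)) (v : List (Fin b)) {i : ℕ}
    (hi : i ≤ C) :
    subtreeStep C lam (pinned τ) v i = lam ^ i * ∏ c : Fin b, compat C i (τ (c :: v)) := by
  unfold subtreeStep
  congr 1
  refine Finset.prod_congr rfl fun c _ => ?_
  rw [← sum_compat_mul hi, Finset.sum_eq_single (τ (c :: v))]
  · simp [pinned]
  · intro j _ hj
    rw [pinned, if_neg (fun h => hj (Fin.ext h)), mul_zero]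
  · simp

/-- Summing out the last level. -/
lemma siteSum_level (k : ℕ) (W : List (Fin b) → ℕ → ℝ) (σ : List (Fin b) → Fin (C + 1)) :
    siteSum (level b (k + 1))
      (fun σ => ballWeight lam (k + 1) σ * ∏ v ∈ level b (k + 1), W v (σ v)) σ =
      ballWeight lam k σ * ∏ v ∈ level b k, subtreeStep C lam W v (σ v) := by
  classical
  have hlow : ∀ (ξ : level b (k + 1) → Fin (C + 1)) (v : List (Fin b)), v ∈ ball b (k + 1) →
      glue (level b (k + 1)) ξ σ v = σ v := fun ξ v hv => glue_of_notMem fun h => by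
    rw [mem_ball] at hv; rw [mem_level] at h; omega
  have hterm : ∀ ξ : level b (k + 1) → Fin (C + 1),
      ballWeight lam (k + 1) (glue (level b (k + 1)) ξ σ) *
        ∏ v ∈ level b (k + 1), W v (glue (level b (k + 1)) ξ σ v) =
      (ballWeight lam k σ * ∏ v ∈ level b k, lam ^ (σ v : ℕ)) *
        ∏ w : level b (k + 1), compat C (σ (w : List (Fin b)).tail) (ξ w) * W w (ξ w) := by
    intro ξ
    set ρ := glue (level b (k + 1)) ξ σ with hρ
    have e1 : ballWeight lam k ρ = ballWeight lam k σ :=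
      dependsOn_ballWeight k fun v hv => hlow ξ v hv
    have e2 : ∏ w : level b (k + 1), compat C (σ (w : List (Fin b)).tail) (ξ w) * W w (ξ w) =
        ∏ w ∈ level b (k + 1), compat C (σ w.tail) (ρ w) * W w (ρ w) := by
      rw [← Finset.prod_coe_sort (level b (k + 1)) fun w => compat C (σ w.tail) (ρ w) * W w (ρ w)]
      refine Finset.prod_congr rfl fun w _ => ?_
      rw [hρ, glue_of_mem w.2]
    have e3 : ∏ w ∈ level b (k + 1), compat C (σ w.tail) (ρ w) =
        ∏ v ∈ level b k, ∏ c : Fin b, compat C (σ v) (ρ (c :: v)) := by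
      rw [prod_level_succ]; rfl
    have e4 : ∏ v ∈ level b k, vertexWeight lam ρ v =
        ∏ v ∈ level b k, lam ^ (σ v : ℕ) * ∏ c : Fin b, compat C (σ v) (ρ (c :: v)) := by
      refine Finset.prod_congr rfl fun v hv => ?_
      have hv' : ρ v = σ v := hlow ξ v (by rw [mem_ball_succ]; exact Or.inr hv)
      rw [vertexWeight, hv']
    rw [e2, Finset.prod_mul_distrib, e3]
    conv_lhs => rw [ballWeight, prod_ball_succ, e4, Finset.prod_mul_distrib]
    rw [← e1, ballWeight]
    ring
  unfold siteSum
  simp only [hterm]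
  rw [← Finset.mul_sum]
  trans (ballWeight lam k σ * ∏ v ∈ level b k, lam ^ (σ v : ℕ)) *
    ∏ w ∈ level b (k + 1), ∑ j ∈ Finset.range (C - σ w.tail + 1), W w j
  · congr 1
    rw [← Finset.prod_coe_sort (level b (k + 1))
      fun w => ∑ j ∈ Finset.range (C - σ w.tail + 1), W w j]
    simp only [← sum_compat_mul (Nat.le_of_lt_succ (σ _).2)]
    rw [Finset.prod_univ_sum, Fintype.piFinset_univ]
    exact Finset.sum_congr (by ext; simp) fun _ _ => rfl
  · rw [prod_level_succ, mul_assoc, ← Finset.prod_mul_distrib]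
    rfl

lemma siteSum_ball_iterate (k m : ℕ) (W : List (Fin b) → ℕ → ℝ)
    {f : (List (Fin b) → Fin (C + 1)) → ℝ}
    (hf : DependsOn f (ball b (k + 1) : Set (List (Fin b)))) (τ : List (Fin b) → Fin (C + 1)) :
    siteSum (ball b (k + m + 1)) (fun σ => (ballWeight lam (k + m) σ *
      ∏ v ∈ level b (k + m), W v (σ v)) * f σ) τ =
    siteSum (ball b (k + 1)) (fun σ => (ballWeight lam k σ *
      ∏ v ∈ level b k, (subtreeStep C lam)^[m] W v (σ v)) * f σ) τ := by
  induction m generalizing W with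
  | zero => rfl
  | succ m ih =>
    rw [Function.iterate_succ_apply, ← ih, siteSum_union (disjoint_ball_level (k + (m + 1)))
      mem_ball_succ]
    refine siteSum_congr fun ξ => ?_
    have hf' : DependsOn f ((level b (k + (m + 1)) : Set (List (Fin b)))ᶜ) := fun σ σ' h =>
      hf fun v hv => h v (by
        have := mem_ball.1 (Finset.mem_coe.1 hv)
        simp; omega)
    rw [siteSum_mul_right hf']
    congr 1
    exact siteSum_level (k + m) W _

/-- The marginal on the first `k + 1` levels of the model on `k + m + 1` levels, with boundary
condition `τ`, is given by the weights of the subtrees at level `k`. -/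
theorem siteSum_hullWeight_ball (k m : ℕ) {f : (List (Fin b) → Fin (C + 1)) → ℝ}
    (hf : DependsOn f (ball b (k + 1) : Set (List (Fin b)))) (τ : List (Fin b) → Fin (C + 1)) :
    siteSum (ball b (k + m + 1))
      (fun σ => hullWeight (tree b) C lam (ball b (k + m + 1)) σ * f σ) τ =
    siteSum (ball b (k + 1)) (fun σ => (ballWeight lam k σ *
      ∏ v ∈ level b k, (subtreeStep C lam)^[m + 1] (pinned τ) v (σ v)) * f σ) τ := by
  rw [Function.iterate_succ_apply, ← siteSum_ball_iterate k m _ hf]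
  refine siteSum_congr fun ξ => ?_
  congr 1
  rw [hullWeight_ball, ballWeight, prod_ball_succ]
  congr 1
  refine Finset.prod_congr rfl fun v hv => ?_
  rw [mem_level] at hv
  rw [subtreeStep_pinned _ _ (Nat.le_of_lt_succ (Fin.isLt _)), vertexWeight]
  congr 1
  refine Finset.prod_congr rfl fun c _ => ?_
  rw [glue_of_notMem (v := c :: v) (by simp; omega)]

end Tree

/-! ### Phase coexistence -/

section Coexistence
variable {b C p : ℕ} {lam : ℝ}

/-- The recursion for the weights of subtrees when all subtrees at the same level are alike. -/
def homStep (b C : ℕ) (lam : ℝ) (z : ℕ → ℝ) (i : ℕ) : ℝ :=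
  lam ^ i * (∑ j ∈ Finset.range (C - i + 1), z j) ^ b

lemma subtreeStep_const (z : ℕ → ℝ) :
    subtreeStep (b := b) C lam (fun _ => z) = fun _ => homStep b C lam z := by
  funext v i
  simp [subtreeStep, homStep]

lemma subtreeStep_iterate_const (z : ℕ → ℝ) (n : ℕ) :
    (subtreeStep (b := b) C lam)^[n] (fun _ => z) = fun _ => (homStep b C lam)^[n] z := by
  induction n generalizing z with
  | zero => rfl
  | succ n ih => rw [Function.iterate_succ_apply, subtreeStep_const, ih]; rfl

/-- The total weight of the spins below `p`. -/
def lowSum (p : ℕ) (z : ℕ → ℝ) : ℝ := ∑ i ∈ Finset.range p, z i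

/-- The total weight of the spins from `p` up to `2 * p - 1`. -/
def highSum (p : ℕ) (z : ℕ → ℝ) : ℝ := ∑ i ∈ Finset.range p, z (p + i)

lemma lowSum_add_highSum (hp : C + 1 = 2 * p) (z : ℕ → ℝ) :
    lowSum p z + highSum p z = ∑ i ∈ Finset.range (C + 1), z i := by
  rw [hp, two_mul, Finset.sum_range_add]; rfl

lemma homStep_nonneg (hl : 0 ≤ lam) {z : ℕ → ℝ} (hz : ∀ i, 0 ≤ z i) (i : ℕ) :
    0 ≤ homStep b C lam z i :=
  mul_nonneg (pow_nonneg hl _) (pow_nonneg (Finset.sum_nonneg fun _ _ => hz _) _)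

lemma highSum_homStep_le (hp : C + 1 = 2 * p) (hl : 0 ≤ lam) {z : ℕ → ℝ} (hz : ∀ i, 0 ≤ z i) :
    highSum p (homStep b C lam z) ≤
      (∑ i ∈ Finset.range p, lam ^ i) * lam ^ p * lowSum p z ^ b := by
  rw [highSum, Finset.sum_mul, Finset.sum_mul]
  refine Finset.sum_le_sum fun i hi => ?_
  rw [homStep, pow_add, mul_comm (lam ^ p)]
  have hi' := Finset.mem_range.1 hi
  have : ∑ j ∈ Finset.range (C - (p + i) + 1), z j ≤ lowSum p z :=
    Finset.sum_le_sum_of_subset_of_nonneg (Finset.range_mono (by omega)) fun _ _ _ => hz _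
  have h0 : 0 ≤ ∑ j ∈ Finset.range (C - (p + i) + 1), z j := Finset.sum_nonneg fun _ _ => hz _
  gcongr

lemma le_highSum_homStep (hp : C + 1 = 2 * p) (hl : 0 ≤ lam) {z : ℕ → ℝ}
    (hz : ∀ i, 0 ≤ z i) : lam ^ p * lowSum p z ^ b ≤ highSum p (homStep b C lam z) := by
  have := Finset.single_le_sum (f := fun i => homStep b C lam z (p + i))
    (fun i _ => homStep_nonneg hl hz _) (Finset.mem_range.2 (show 0 < p by omega))
  refine le_trans (le_of_eq ?_) this
  have e : C - p + 1 = p := by omega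
  simp only [homStep, lowSum, add_zero, e]

lemma lowSum_homStep_le (hp : C + 1 = 2 * p) (hl : 0 ≤ lam) {z : ℕ → ℝ} (hz : ∀ i, 0 ≤ z i) :
    lowSum p (homStep b C lam z) ≤
      (∑ i ∈ Finset.range p, lam ^ i) * (lowSum p z + highSum p z) ^ b := by
  rw [lowSum_add_highSum hp, lowSum, Finset.sum_mul]
  refine Finset.sum_le_sum fun i hi => ?_
  rw [homStep]
  have : ∑ j ∈ Finset.range (C - i + 1), z j ≤ ∑ j ∈ Finset.range (C + 1), z j :=
    Finset.sum_le_sum_of_subset_of_nonneg (Finset.range_mono (by omega)) fun _ _ _ => hz _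
  have h0 : 0 ≤ ∑ j ∈ Finset.range (C - i + 1), z j := Finset.sum_nonneg fun _ _ => hz _
  gcongr

lemma le_lowSum_homStep (hp : C + 1 = 2 * p) (hl : 0 ≤ lam) {z : ℕ → ℝ}
    (hz : ∀ i, 0 ≤ z i) : (lowSum p z + highSum p z) ^ b ≤ lowSum p (homStep b C lam z) := by
  have := Finset.single_le_sum (f := fun i => homStep b C lam z i)
    (fun i _ => homStep_nonneg hl hz _) (Finset.mem_range.2 (show 0 < p by omega))
  refine le_trans (le_of_eq ?_) this
  rw [lowSum_add_highSum hp]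
  simp [homStep]

/-- From the spin `0` at the leaves, the ratio of high to low weights is at most `x` after an even
number of steps, and at least `y` after an odd number of steps. -/
lemma iterate_homStep_trapped (hp : C + 1 = 2 * p) (hl : 0 < lam) {x y : ℝ}
    (hx : 0 < x) (hy : 0 < y)
    (h1 : (∑ i ∈ Finset.range p, lam ^ i) * lam ^ p ≤ x * (1 + y) ^ b)
    (h2 : (∑ i ∈ Finset.range p, lam ^ i) * (y * (1 + x) ^ b) ≤ lam ^ p) (n : ℕ) :
    let z := (homStep b C lam)^[n] (fun i => if i = 0 then 1 else 0)
    (∀ i, 0 ≤ z i) ∧ 0 < lowSum p z ∧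
      (Even n → highSum p z ≤ x * lowSum p z) ∧ (¬ Even n → y * lowSum p z ≤ highSum p z) := by
  have ha : 0 ≤ ∑ i ∈ Finset.range p, lam ^ i := Finset.sum_nonneg fun _ _ => by positivity
  induction n with
  | zero =>
    refine ⟨fun i => ?_, ?_, fun _ => ?_, fun h => absurd Even.zero h⟩
    · simp only [Function.iterate_zero, id]; split_ifs <;> norm_num
    · have : p ≠ 0 := by omega
      simp [lowSum, Nat.pos_iff_ne_zero, this]
    · have : p ≠ 0 := by omega
      simp [lowSum, highSum, Nat.pos_iff_ne_zero, this, hx.le]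
  | succ n ih =>
    simp only [Function.iterate_succ_apply'] at ih ⊢
    generalize (homStep b C lam)^[n] (fun i => if i = 0 then (1 : ℝ) else 0) = z at ih ⊢
    obtain ⟨hz, hlow, he, ho⟩ := ih
    have hhigh : 0 ≤ highSum p z := Finset.sum_nonneg fun _ _ => hz _
    refine ⟨homStep_nonneg hl.le hz, ?_, fun hn => ?_, fun hn => ?_⟩
    · exact lt_of_lt_of_le (by positivity) (le_lowSum_homStep hp hl.le hz)
    · have hT := ho (by rw [Nat.even_add_one] at hn; exact hn)
      calc highSum p (homStep b C lam z) ≤ _ := highSum_homStep_le hp hl.le hz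
        _ ≤ x * (1 + y) ^ b * lowSum p z ^ b := by gcongr
        _ = x * ((1 + y) * lowSum p z) ^ b := by rw [mul_pow]; ring
        _ ≤ x * (lowSum p z + highSum p z) ^ b := by gcongr; linarith
        _ ≤ _ := by gcongr; exact le_lowSum_homStep hp hl.le hz
    · have hT := he (by rw [Nat.even_add_one] at hn; exact not_not.1 hn)
      calc y * lowSum p (homStep b C lam z)
          ≤ y * ((∑ i ∈ Finset.range p, lam ^ i) * (lowSum p z + highSum p z) ^ b) := by
            gcongr; exact lowSum_homStep_le hp hl.le hz
        _ ≤ y * ((∑ i ∈ Finset.range p, lam ^ i) * ((1 + x) * lowSum p z) ^ b) := by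
            gcongr; linarith
        _ = (∑ i ∈ Finset.range p, lam ^ i) * (y * (1 + x) ^ b) * lowSum p z ^ b := by
            rw [mul_pow]; ring
        _ ≤ lam ^ p * lowSum p z ^ b := by gcongr
        _ ≤ _ := le_highSum_homStep hp hl.le hz

lemma siteSum_ball_one (g : Fin (C + 1) → ℝ) (τ : List (Fin b) → Fin (C + 1)) :
    siteSum (ball b 1) (fun σ => g (σ [])) τ = ∑ i, g i := by
  classical
  have h0 : ([] : List (Fin b)) ∈ ball b 1 := by simp
  unfold siteSum
  let e : (ball b 1 → Fin (C + 1)) ≃ Fin (C + 1) :=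
    { toFun := fun ξ => ξ ⟨[], h0⟩
      invFun := fun i _ => i
      left_inv := fun ξ => by
        funext v
        have : v = ⟨[], h0⟩ := Subtype.ext (by have := mem_ball.1 v.2; simpa using this)
        rw [this]
      right_inv := fun _ => rfl }
  exact Finset.sum_equiv e (by simp) fun ξ _ => by
    beta_reduce
    rw [glue_of_mem h0]; rfl

lemma ballWeight_zero (σ : List (Fin b) → Fin (C + 1)) : ballWeight lam 0 σ = 1 := by
  refine Finset.prod_eq_one fun v hv => ?_
  simp at hv

lemma sum_ite_le_eq_highSum (hp : C + 1 = 2 * p) (z : ℕ → ℝ) :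
    ∑ i : Fin (C + 1), z i * (if p ≤ (i : ℕ) then 1 else 0) = highSum p z := by
  rw [Fin.sum_univ_eq_sum_range (fun i => z i * (if p ≤ i then 1 else 0)) (C + 1), hp, two_mul,
    Finset.sum_range_add, highSum, Finset.sum_eq_zero, zero_add]
  · simp
  · intro i hi
    rw [if_neg (by simpa using hi), mul_zero]

/-- The indicator of the event that the spin at the root is at least `p`. -/
def rootHigh (b C p : ℕ) (σ : List (Fin b) → Fin (C + 1)) : ℝ := if p ≤ (σ [] : ℕ) then 1 else 0

lemma dependsOn_rootHigh : DependsOn (rootHigh b C p) (ball b (0 + 1) : Set (List (Fin b))) := by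
  intro σ σ' h
  unfold rootHigh
  rw [h [] (by simp)]

lemma root_marginal (hp : C + 1 = 2 * p) (m : ℕ) :
    siteSum (ball b (m + 1)) (fun σ => hullWeight (tree b) C lam (ball b (m + 1)) σ *
      rootHigh b C p σ) (fun _ => 0) =
      highSum p ((homStep b C lam)^[m + 1] (fun i => if i = 0 then 1 else 0)) ∧
    siteSum (ball b (m + 1)) (hullWeight (tree b) C lam (ball b (m + 1))) (fun _ => 0) =
      lowSum p ((homStep b C lam)^[m + 1] (fun i => if i = 0 then 1 else 0)) +
      highSum p ((homStep b C lam)^[m + 1] (fun i => if i = 0 then 1 else 0)) := by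
  have hpin : pinned (b := b) (C := C) (fun _ => 0) = fun _ i => if i = 0 then (1 : ℝ) else 0 := by
    funext v i; rfl
  constructor
  · have := siteSum_hullWeight_ball (lam := lam) 0 m (dependsOn_rootHigh (b := b) (C := C) (p := p))
      (fun _ => 0)
    rw [zero_add] at this
    rw [this, hpin, subtreeStep_iterate_const, ← sum_ite_le_eq_highSum hp]
    simp only [level_zero, Finset.prod_singleton, rootHigh, ballWeight_zero, one_mul]
    rw [← siteSum_ball_one (b := b) (fun i : Fin (C + 1) =>
      (homStep b C lam)^[m + 1] (fun i => if i = 0 then 1 else 0) i *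
        (if p ≤ (i : ℕ) then 1 else 0)) (fun _ => 0), zero_add]
  · have := siteSum_hullWeight_ball (b := b) (C := C) (lam := lam) 0 m (f := fun _ => 1)
      (fun _ _ _ => rfl) (fun _ => 0)
    rw [zero_add] at this
    simp only [mul_one] at this
    rw [this, hpin, subtreeStep_iterate_const, lowSum_add_highSum hp]
    simp only [level_zero, Finset.prod_singleton, ballWeight_zero, one_mul]
    rw [← Fin.sum_univ_eq_sum_range, ← siteSum_ball_one (b := b) (fun i : Fin (C + 1) =>
      (homStep b C lam)^[m + 1] (fun i => if i = 0 then 1 else 0) i) (fun _ => 0)]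

lemma eventually_subset_ball (U : Finset (List (Fin b))) :
    ∀ᶠ n in Filter.atTop, U ⊆ ball b n := by
  obtain ⟨n, hn⟩ := exists_subset_ball U
  filter_upwards [Filter.eventually_ge_atTop n] with m hm
  exact hn.trans (ball_mono hm)

lemma phaseCoexistence_of_trap (hp : C + 1 = 2 * p) (hl : 0 < lam) {x y : ℝ}
    (hx : 0 < x) (hxy : x < y)
    (h1 : (∑ i ∈ Finset.range p, lam ^ i) * lam ^ p ≤ x * (1 + y) ^ b)
    (h2 : (∑ i ∈ Finset.range p, lam ^ i) * (y * (1 + x) ^ b) ≤ lam ^ p) :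
    PhaseCoexistence (tree b) C lam := by
  have hy : 0 < y := hx.trans hxy
  have htrap := iterate_homStep_trapped (b := b) hp hl hx hy h1 h2
  have te : Filter.Tendsto (fun n : ℕ => 2 * n + 2) Filter.atTop Filter.atTop :=
    Filter.tendsto_atTop_mono (fun n => by simp only [id]; omega) Filter.tendsto_id
  have tO : Filter.Tendsto (fun n : ℕ => 2 * n + 1) Filter.atTop Filter.atTop :=
    Filter.tendsto_atTop_mono (fun n => by simp only [id]; omega) Filter.tendsto_id
  let l := Ultrafilter.of (Filter.atTop : Filter ℕ)
  have hle : (l : Filter ℕ) ≤ Filter.atTop := Ultrafilter.of_le _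
  obtain ⟨μ, hμ, hμt⟩ := exists_isGibbs_tendsto (C := C) hl finite_boundary_tree (ball b)
    eventually_subset_ball (l.map fun n => 2 * n + 2) ((Filter.map_mono hle).trans te)
  obtain ⟨ν, hν, hνt⟩ := exists_isGibbs_tendsto (C := C) hl finite_boundary_tree (ball b)
    eventually_subset_ball (l.map fun n => 2 * n + 1) ((Filter.map_mono hle).trans tO)
  refine ⟨μ, ν, hμ, hν, fun h => ?_⟩
  have bμ : ∫ σ, rootHigh b C p σ ∂μ ≤ x / (1 + x) := by
    refine le_of_tendsto (hμt _ _ dependsOn_rootHigh) ?_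
    rw [Ultrafilter.coe_map, Filter.eventually_map]
    refine Filter.Eventually.of_forall fun n => ?_
    obtain ⟨e1, e2⟩ := root_marginal (b := b) (lam := lam) hp (2 * n + 1)
    rw [e1, e2]
    obtain ⟨hz, hlow, he, -⟩ := htrap (2 * n + 1 + 1)
    have hb := he ⟨n + 1, by ring⟩
    have hh := Finset.sum_nonneg (s := Finset.range p) fun i _ => hz (p + i)
    rw [← highSum] at hh
    rw [div_le_div_iff₀ (by linarith) (by linarith)]
    nlinarith
  have bν : y / (1 + y) ≤ ∫ σ, rootHigh b C p σ ∂ν := by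
    refine ge_of_tendsto (hνt _ _ dependsOn_rootHigh) ?_
    rw [Ultrafilter.coe_map, Filter.eventually_map]
    refine Filter.Eventually.of_forall fun n => ?_
    obtain ⟨e1, e2⟩ := root_marginal (b := b) (lam := lam) hp (2 * n)
    rw [e1, e2]
    obtain ⟨hz, hlow, -, ho⟩ := htrap (2 * n + 1)
    have hb := ho (by simp)
    have hh := Finset.sum_nonneg (s := Finset.range p) fun i _ => hz (p + i)
    rw [← highSum] at hh
    rw [div_le_div_iff₀ (by linarith) (by linarith)]
    nlinarith
  have : x / (1 + x) < y / (1 + y) := by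
    rw [div_lt_div_iff₀ (by linarith) (by linarith)]; linarith
  rw [h] at bμ
  linarith

theorem exists_phaseCoexistence (hC : Odd C) {γ : ℝ} (hγ : Real.exp 1 < γ) :
    ∃ b₀ : ℕ, ∀ b : ℕ, b₀ ≤ b → ∀ lam : ℝ,
        (γ / (b : ℝ)) ^ (1 / (jc C : ℝ)) ≤ lam → lam < 1 → PhaseCoexistence (tree b) C lam := by
  have hp := jc_spec hC
  have hp1 : 1 ≤ jc C := by omega
  obtain ⟨b₀, hb₀, H⟩ := exists_trap hγ (show (1 : ℝ) ≤ jc C by exact_mod_cast hp1) hp1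
  refine ⟨b₀, fun b hb lam h1 hl1 => ?_⟩
  obtain ⟨hl0, hm⟩ :=
    pos_and_le_mul_pow_of_rpow_le ((Real.exp_pos 1).trans hγ) (hb₀.trans hb) hp1 h1
  obtain ⟨x, y, hx, hxy, g1, g2⟩ := H b hb lam (∑ i ∈ Finset.range (jc C), lam ^ i) hl0 hl1
    (by
      have := Finset.single_le_sum (f := fun i => lam ^ i) (fun i _ => pow_nonneg hl0.le _)
        (Finset.mem_range.2 (show 0 < jc C by omega))
      simpa using this)
    (by
      calc ∑ i ∈ Finset.range (jc C), lam ^ i ≤ ∑ i ∈ Finset.range (jc C), (1 : ℝ) :=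
            Finset.sum_le_sum fun i _ => pow_le_one₀ hl0.le hl1.le
        _ = jc C := by simp)
    (by
      rw [← tsum_geometric_of_lt_one hl0.le hl1]
      exact (summable_geometric_of_lt_one hl0.le hl1).sum_le_tsum _ fun i _ => pow_nonneg hl0.le _)
    hm
  exact phaseCoexistence_of_trap hp hl0 hx hxy g1 g2

end Coexistence

/-! ### Contraction of the recursion -/

section Contraction

/-- The function `(1 + t) ^ (-b / 2)`. -/
def decay (b : ℕ) (t : ℝ) : ℝ := (Real.sqrt (1 + t) ^ b)⁻¹

variable {b : ℕ}

lemma one_le_sqrt_one_add {t : ℝ} (ht : 0 ≤ t) : 1 ≤ Real.sqrt (1 + t) := by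
  rw [Real.one_le_sqrt]; linarith

lemma decay_nonneg (t : ℝ) : 0 ≤ decay b t := by unfold decay; positivity

lemma decay_zero : decay b 0 = 1 := by simp [decay]

lemma decay_anti {s t : ℝ} (hs : 0 ≤ s) (hst : s ≤ t) : decay b t ≤ decay b s := by
  have := one_le_sqrt_one_add hs
  unfold decay
  gcongr

lemma decay_le_one {t : ℝ} (ht : 0 ≤ t) : decay b t ≤ 1 := by
  rw [← decay_zero (b := b)]; exact decay_anti le_rfl ht

lemma decay_sub_le {s t : ℝ} (hs : 0 ≤ s) (hst : s ≤ t) :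
    decay b s - decay b t ≤ b / 2 * decay b s * (t - s) := by
  set x := Real.sqrt (1 + s) with hx
  set y := Real.sqrt (1 + t) with hy
  have hx1 : 1 ≤ x := one_le_sqrt_one_add hs
  have hxy : x ≤ y := Real.sqrt_le_sqrt (by linarith)
  have hx2 : x ^ 2 = 1 + s := Real.sq_sqrt (by linarith)
  have hy2 : y ^ 2 = 1 + t := Real.sq_sqrt (by linarith)
  have hy0 : 0 < y := by linarith
  have hr : 1 - (t - s) / 2 ≤ x / y := by
    rw [le_div_iff₀ hy0]
    have : t - s = (y - x) * (y + x) := by ring_nf; rw [hx2, hy2]; ring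
    rw [this]
    nlinarith [mul_nonneg (sub_nonneg.2 hxy) (show 0 ≤ y * (y + x) - 2 by nlinarith)]
  have hB := one_add_mul_le_pow (a := x / y - 1) (by
    have : 0 ≤ x / y := by positivity
    linarith) b
  have e : decay b t = decay b s * (x / y) ^ b := by
    unfold decay
    rw [← hx, ← hy, div_pow]
    have : x ^ b ≠ 0 := by positivity
    field_simp
  have hd := decay_nonneg (b := b) s
  rw [add_sub_cancel] at hB
  have h3 : 1 - (b : ℝ) * ((t - s) / 2) ≤ (x / y) ^ b := by
    refine le_trans ?_ hB
    have : (0 : ℝ) ≤ b := by positivity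
    nlinarith
  rw [e]
  nlinarith

lemma decay_mul_le {t : ℝ} (ht : 0 ≤ t) (ht2 : t ≤ 2) : b * t * decay b t ≤ 3 := by
  set x := Real.sqrt (1 + t) with hx
  have hx1 : 1 ≤ x := one_le_sqrt_one_add ht
  have hx2 : x ^ 2 = 1 + t := Real.sq_sqrt (by linarith)
  have hB := one_add_mul_le_pow (a := x - 1) (by linarith) b
  rw [add_sub_cancel] at hB
  unfold decay
  rw [← div_eq_mul_inv, div_le_iff₀ (by positivity)]
  have h1 : t ≤ 3 * (x - 1) := by nlinarith
  have : (0 : ℝ) ≤ b := by positivity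
  nlinarith

/-- The sharp form of the maximum of `w (1 + w / b) ^ (-b)`, attained near `w = 1`. -/
lemma mul_pow_le_one_add_div_pow (hb : 1 ≤ b) {w : ℝ} (hw : 0 ≤ w) :
    w * (1 + 1 / (b : ℝ)) ^ (b - 1) ≤ (1 + w / b) ^ b := by
  have hb0 : (0 : ℝ) < b := by exact_mod_cast hb
  -- Bernoulli's inequality around `w = 1`
  have h1 : 1 + w / b = (1 + 1 / (b : ℝ)) * (1 + (w - 1) / (b + 1)) := by field_simp; ring
  have h2 := one_add_mul_le_pow (a := (w - 1) / ((b : ℝ) + 1)) (by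
    rw [le_div_iff₀ (by linarith)]; nlinarith) b
  have h3 : w ≤ (1 + 1 / (b : ℝ)) * (1 + b * ((w - 1) / (b + 1))) := by
    have : (1 + 1 / (b : ℝ)) * (1 + b * ((w - 1) / (b + 1))) = w + 1 / b := by field_simp; ring
    rw [this]
    have : 0 < 1 / (b : ℝ) := by positivity
    linarith
  have h4 : (1 + 1 / (b : ℝ)) ^ b = (1 + 1 / (b : ℝ)) ^ (b - 1) * (1 + 1 / (b : ℝ)) := by
    rw [← pow_succ, Nat.sub_add_cancel hb]
  rw [h1, mul_pow, h4]
  calc w * (1 + 1 / (b : ℝ)) ^ (b - 1)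
      ≤ ((1 + 1 / (b : ℝ)) * (1 + b * ((w - 1) / (b + 1)))) * (1 + 1 / (b : ℝ)) ^ (b - 1) := by
        gcongr
    _ ≤ ((1 + 1 / (b : ℝ)) * (1 + (w - 1) / (b + 1)) ^ b) * (1 + 1 / (b : ℝ)) ^ (b - 1) := by
        gcongr
    _ = _ := by ring

/-- In the coordinate `θ = (1 + x) ^ (-b / 2)` the one-level map of the hard core model contracts
with the factor `q`, where `q ^ 2` bounds the ratio of `b λ` to its critical value. -/
lemma decay_sq_sub_le (hb : 1 ≤ b) {γ q s ν x y : ℝ} (hq : 0 ≤ q)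
    (hγ : γ ≤ q ^ 2 * (1 + 1 / (b : ℝ)) ^ (b - 1)) (hν : 0 ≤ ν) (hbν : b * ν ≤ γ)
    (hs : 0 ≤ s) (hxy : x ≤ y) :
    decay b (s + ν * x ^ 2) - decay b (s + ν * y ^ 2) ≤ q * (y - x) := by
  have hb0 : (0 : ℝ) < b := by exact_mod_cast hb
  have hder : ∀ x : ℝ, HasDerivAt (fun x => -decay b (s + ν * x ^ 2))
      ((b * ν * x) * (1 + (s + ν * x ^ 2))⁻¹ * (Real.sqrt (1 + (s + ν * x ^ 2)) ^ b)⁻¹) x := by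
    intro x
    have hpos : 0 < 1 + (s + ν * x ^ 2) := by positivity
    have h1 : HasDerivAt (fun x => 1 + (s + ν * x ^ 2)) (ν * (2 * x)) x := by
      have := (((hasDerivAt_pow 2 x).const_mul ν).const_add s).const_add 1
      simpa using this
    have h2 := ((h1.sqrt hpos.ne').fun_pow b).fun_inv
      (pow_pos (Real.sqrt_pos.2 hpos) b).ne'
    unfold decay
    refine h2.neg.congr_deriv ?_
    have hsq : Real.sqrt (1 + (s + ν * x ^ 2)) ^ 2 = 1 + (s + ν * x ^ 2) :=
      Real.sq_sqrt hpos.le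
    have hsp : 0 < Real.sqrt (1 + (s + ν * x ^ 2)) := Real.sqrt_pos.2 hpos
    generalize Real.sqrt (1 + (s + ν * x ^ 2)) = r at hsq hsp ⊢
    rw [← hsq]
    have : r ^ b = r ^ (b - 1) * r := by rw [← pow_succ, Nat.sub_add_cancel hb]
    rw [this]
    field_simp
  have hbound : ∀ x : ℝ, (b * ν * x) * (1 + (s + ν * x ^ 2))⁻¹ *
      (Real.sqrt (1 + (s + ν * x ^ 2)) ^ b)⁻¹ ≤ q := by
    intro x
    have hx2 : 0 ≤ ν * x ^ 2 := by positivity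
    set u := 1 + (s + ν * x ^ 2) with hu
    have hu1 : 1 ≤ u := by linarith
    set r := Real.sqrt u ^ b with hr
    have hr0 : 0 < r := by have := Real.sqrt_pos.2 (show 0 < u by linarith); positivity
    have hr2 : r ^ 2 = u ^ b := by rw [hr, ← pow_mul, mul_comm, pow_mul, Real.sq_sqrt (by linarith)]
    have h1 : b * ν * x ≤ q * r := by
      have hw : 0 ≤ b * (ν * x ^ 2) := by positivity
      have h2 := mul_pow_le_one_add_div_pow hb hw
      have h3 : 1 + b * (ν * x ^ 2) / b ≤ u := by
        rw [mul_div_cancel_left₀ _ hb0.ne']; linarith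
      refine le_of_abs_le (abs_le_of_sq_le_sq ?_ (by positivity))
      calc (b * ν * x) ^ 2 = (b * ν) * (b * (ν * x ^ 2)) := by ring
        _ ≤ (q ^ 2 * (1 + 1 / (b : ℝ)) ^ (b - 1)) * (b * (ν * x ^ 2)) := by
          exact mul_le_mul_of_nonneg_right (hbν.trans hγ) hw
        _ = q ^ 2 * (b * (ν * x ^ 2) * (1 + 1 / (b : ℝ)) ^ (b - 1)) := by ring
        _ ≤ q ^ 2 * (1 + b * (ν * x ^ 2) / b) ^ b := by gcongr
        _ ≤ q ^ 2 * u ^ b := by gcongr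
        _ = (q * r) ^ 2 := by rw [← hr2]; ring
    have : (b * ν * x) * u⁻¹ * r⁻¹ = (b * ν * x) / (u * r) := by field_simp
    rw [this, div_le_iff₀ (by positivity)]
    calc b * ν * x ≤ q * r * 1 := by linarith
      _ ≤ q * r * u := by gcongr
      _ = q * (u * r) := by ring
  have := image_sub_le_mul_sub_of_deriv_le (f := fun x => -decay b (s + ν * x ^ 2))
    (fun x => (hder x).differentiableAt) (C := q) (fun x => by rw [(hder x).deriv]; exact hbound x)
    hxy
  linarith

/-- The part `∑ i ≤ k` of the normalization in one step of the recursion. -/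
def headSum (C : ℕ) (lam : ℝ) (θ : ℕ → ℝ) (k : ℕ) : ℝ :=
  ∑ i ∈ Finset.Ico 0 (k + 1), lam ^ i * θ (C - i) ^ 2

/-- The part `∑ i > k` of the normalization in one step of the recursion. -/
def tailSum (C : ℕ) (lam : ℝ) (θ : ℕ → ℝ) (k : ℕ) : ℝ :=
  ∑ i ∈ Finset.Ico (k + 1) (C + 1), lam ^ i * θ (C - i) ^ 2

/-- The recursion in terms of `θ k = F k ^ (b / 2)`, for `F` the distribution function of the
spin at the root of a subtree. -/
def thetaStep (b C : ℕ) (lam : ℝ) (θ : ℕ → ℝ) (k : ℕ) : ℝ :=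
  decay b (tailSum C lam θ k / headSum C lam θ k)

lemma sum_Ico_pow_le {lam : ℝ} (hl : 0 ≤ lam) (hl2 : lam ≤ 1 / 2) (m n : ℕ) :
    ∑ i ∈ Finset.Ico m n, lam ^ i ≤ 2 * lam ^ m := by
  refine (geom_sum_Ico_le_of_lt_one hl (by linarith)).trans ?_
  rw [div_le_iff₀ (by linarith)]
  have : 0 ≤ lam ^ m := by positivity
  nlinarith

/-- The weight of the coordinate `k` in the norm for which the recursion contracts: differences in
this coordinate are measured in multiples of it. The coordinates below `p - 1` depend on the
others with constants up to about `51`, and are allowed to vary twice as much. -/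
def coordWeight (p k : ℕ) : ℝ := if k + 1 < p then 104 else 1

lemma coordWeight_le (p k : ℕ) : coordWeight p k ≤ 104 := by
  unfold coordWeight; split_ifs <;> norm_num

lemma one_le_coordWeight (p k : ℕ) : 1 ≤ coordWeight p k := by
  unfold coordWeight; split_ifs <;> norm_num

section Step
variable {C p : ℕ} {lam δ : ℝ} {θ θ' : ℕ → ℝ}

lemma one_le_headSum (hl : 0 ≤ lam) (hC : θ C = 1) (k : ℕ) : 1 ≤ headSum C lam θ k := by
  have := Finset.single_le_sum (f := fun i => lam ^ i * θ (C - i) ^ 2)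
    (fun i _ => by positivity) (Finset.mem_Ico.2 ⟨le_rfl, Nat.succ_pos k⟩)
  simpa [hC, headSum] using this

lemma tailSum_nonneg (hl : 0 ≤ lam) (k : ℕ) : 0 ≤ tailSum C lam θ k :=
  Finset.sum_nonneg fun i _ => by positivity

lemma tailSum_le (hl : 0 ≤ lam) (hl2 : lam ≤ 1 / 2) (h0 : ∀ k ≤ C, 0 ≤ θ k)
    (h1 : ∀ k ≤ C, θ k ≤ 1) (k : ℕ) : tailSum C lam θ k ≤ 2 * lam ^ (k + 1) := by
  refine le_trans (Finset.sum_le_sum fun i _ => ?_) (sum_Ico_pow_le hl hl2 (k + 1) (C + 1))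
  have := pow_le_one₀ (n := 2) (h0 (C - i) (by omega)) (h1 (C - i) (by omega))
  exact mul_le_of_le_one_right (by positivity) this

lemma headSum_le (hl : 0 ≤ lam) (hl2 : lam ≤ 1 / 2) (h0 : ∀ k ≤ C, 0 ≤ θ k)
    (h1 : ∀ k ≤ C, θ k ≤ 1) (k : ℕ) : headSum C lam θ k ≤ 2 := by
  refine le_trans (Finset.sum_le_sum fun i _ => ?_)
    ((sum_Ico_pow_le hl hl2 0 (k + 1)).trans (by simp))
  have := pow_le_one₀ (n := 2) (h0 (C - i) (by omega)) (h1 (C - i) (by omega))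
  exact mul_le_of_le_one_right (by positivity) this

lemma sum_Ico_le_of_sub_le (hl : 0 ≤ lam) (hl2 : lam ≤ 1 / 2) (h0 : ∀ k ≤ C, 0 ≤ θ' k)
    (h1 : ∀ k ≤ C, θ k ≤ 1) (hle : ∀ k ≤ C, θ' k ≤ θ k) {m n : ℕ} {w : ℝ} (hw : 0 ≤ w)
    (hδ : ∀ i, m ≤ i → i < n → θ (C - i) - θ' (C - i) ≤ w) :
    ∑ i ∈ Finset.Ico m n, lam ^ i * θ (C - i) ^ 2 ≤
      (∑ i ∈ Finset.Ico m n, lam ^ i * θ' (C - i) ^ 2) + 4 * w * lam ^ m := by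
  have : ∑ i ∈ Finset.Ico m n, lam ^ i * θ (C - i) ^ 2 ≤
      ∑ i ∈ Finset.Ico m n, (lam ^ i * θ' (C - i) ^ 2 + 2 * w * lam ^ i) := by
    refine Finset.sum_le_sum fun i hi => ?_
    rw [Finset.mem_Ico] at hi
    have e := hδ i hi.1 hi.2
    have a0 := h0 (C - i) (by omega)
    have a1 := h1 (C - i) (by omega)
    have a2 := hle (C - i) (by omega)
    have : θ (C - i) ^ 2 ≤ θ' (C - i) ^ 2 + 2 * w := by nlinarith
    calc lam ^ i * θ (C - i) ^ 2 ≤ lam ^ i * (θ' (C - i) ^ 2 + 2 * w) := by gcongr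
      _ = _ := by ring
  refine this.trans ?_
  rw [Finset.sum_add_distrib, ← Finset.mul_sum]
  have := mul_le_mul_of_nonneg_left (sum_Ico_pow_le hl hl2 m n) (show 0 ≤ 2 * w by linarith)
  linarith

set_option maxHeartbeats 1000000 in
/-- The recursion is a contraction for ordered pairs, in a weighted supremum norm. The spin `p`,
which acts on the coordinate `p - 1`, gives the main term; the coordinates below `p - 1` influence
the others only through activities `λ ^ i` with `i > p`, hence the large weight on them. -/
theorem thetaStep_sub_le (hb : 1 ≤ b) (hp : C + 1 = 2 * p) (hl : 0 < lam) {γ q : ℝ} (hq : 0 ≤ q)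
    (hγ3 : γ ≤ 3) (hγ : γ ≤ q ^ 2 * (1 + 1 / (b : ℝ)) ^ (b - 1)) (hm : b * lam ^ p ≤ γ)
    (hlq : 1248 * lam ≤ 1 - q) (hC' : θ' C = 1) (h0 : ∀ k ≤ C, 0 ≤ θ' k)
    (h1 : ∀ k ≤ C, θ k ≤ 1) (hle : ∀ k ≤ C, θ' k ≤ θ k)
    (hhalf : ∀ k ≤ C, p ≤ k → 1 / 2 ≤ θ' k)
    (hδ0 : 0 ≤ δ) (hδ : ∀ k ≤ C, θ k - θ' k ≤ coordWeight p k * δ) {k : ℕ} (hk : k ≤ C) :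
    thetaStep b C lam θ' k - thetaStep b C lam θ k ≤ coordWeight p k * ((1 + q) / 2 * δ) := by
  have hb0 : (0 : ℝ) < b := by exact_mod_cast hb
  have hl2 : lam ≤ 1 / 2 := by linarith
  have h0' : ∀ k ≤ C, 0 ≤ θ k := fun k hk => (h0 k hk).trans (hle k hk)
  have h1' : ∀ k ≤ C, θ' k ≤ 1 := fun k hk => (hle k hk).trans (h1 k hk)
  set E := tailSum C lam θ k with hE
  set E' := tailSum C lam θ' k with hE'
  set D := headSum C lam θ k with hD
  set D' := headSum C lam θ' k with hD'
  have hD1 : 1 ≤ D' := one_le_headSum hl.le hC' k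
  have hDD : D' ≤ D := by
    refine Finset.sum_le_sum fun i _ => ?_
    have := h0 (C - i) (by omega)
    have := hle (C - i) (by omega)
    gcongr
  have hEE : E' ≤ E := by
    refine Finset.sum_le_sum fun i _ => ?_
    have := h0 (C - i) (by omega)
    have := hle (C - i) (by omega)
    gcongr
  have hE0 : 0 ≤ E' := tailSum_nonneg hl.le k
  have hD0 : 0 < D' := by linarith
  have ht0 : 0 ≤ E' / D' := by positivity
  -- lowering the denominator of the larger argument only helps
  have hred : thetaStep b C lam θ' k - thetaStep b C lam θ k ≤
      decay b (E' / D') - decay b (E / D') := by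
    have : decay b (E / D') ≤ decay b (E / D) := by
      apply decay_anti
      · have : 0 ≤ E := hE0.trans hEE
        have : 0 < D := by linarith
        positivity
      · have : 0 ≤ E := hE0.trans hEE
        gcongr
    unfold thetaStep
    linarith
  refine hred.trans ?_
  have htE : E / D' - E' / D' ≤ E - E' := by
    rw [← sub_div]
    exact div_le_self (by linarith) hD1
  have htt : E' / D' ≤ E / D' := by gcongr
  have hlin := decay_sub_le (b := b) ht0 htt
  have hd0 := decay_nonneg (b := b) (E' / D')
  have hd1 := decay_le_one (b := b) ht0
  have hlinE : decay b (E' / D') - decay b (E / D') ≤ b / 2 * decay b (E' / D') * (E - E') :=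
    hlin.trans (by gcongr)
  have hw : ∀ i, θ (C - i) - θ' (C - i) ≤ 104 * δ := fun i =>
    (hδ (C - i) (by omega)).trans (by gcongr; exact coordWeight_le _ _)
  have hmlam : b * lam ^ (p + 1) ≤ 3 * lam := by
    rw [pow_succ, ← mul_assoc]
    gcongr
    linarith
  -- the contribution of the spins above `p`
  have hhigh : ∑ i ∈ Finset.Ico (p + 1) (C + 1), lam ^ i * θ (C - i) ^ 2 ≤
      (∑ i ∈ Finset.Ico (p + 1) (C + 1), lam ^ i * θ' (C - i) ^ 2) +
        4 * (104 * δ) * lam ^ (p + 1) :=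
    sum_Ico_le_of_sub_le hl.le hl2 h0 h1 hle (by positivity) fun i _ _ => hw i
  have hsmall : b / 2 * (4 * (104 * δ) * lam ^ (p + 1)) ≤ (1 - q) / 2 * δ := by
    calc b / 2 * (4 * (104 * δ) * lam ^ (p + 1)) = 208 * δ * (b * lam ^ (p + 1)) := by ring
      _ ≤ 208 * δ * (3 * lam) := by gcongr
      _ = (1248 * lam) / 2 * δ := by ring
      _ ≤ (1 - q) / 2 * δ := by gcongr
  have hCp : C - p = p - 1 := by omega
  rcases lt_trichotomy (k + 1) p with hkp | hkp | hkp
  · have hwt : coordWeight p k = 104 := if_pos hkp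
    have hlk : lam ^ p ≤ lam ^ (k + 1) := pow_le_pow_of_le_one hl.le (by linarith) hkp.le
    have e1 : E ≤ E' + (4 * δ * lam ^ (k + 1) + (2 * δ * lam ^ p + 4 * (104 * δ) * lam ^ (p + 1))) := by
      have s1 := sum_Ico_le_of_sub_le (θ := θ) (θ' := θ') (C := C) (m := k + 1) (n := p)
        hl.le hl2 h0 h1 hle hδ0
        fun i _ hi => by
          have := hδ (C - i) (by omega)
          rwa [coordWeight, if_neg (by omega), one_mul] at this
      have s2 : θ (p - 1) ^ 2 ≤ θ' (p - 1) ^ 2 + 2 * δ := by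
        have a := hδ (p - 1) (by omega)
        rw [coordWeight, if_neg (by omega), one_mul] at a
        have a0 := h0 (p - 1) (by omega)
        have a1 := h1 (p - 1) (by omega)
        have a2 := hle (p - 1) (by omega)
        nlinarith
      have s3 : lam ^ p * θ (p - 1) ^ 2 ≤ lam ^ p * θ' (p - 1) ^ 2 + 2 * δ * lam ^ p := by
        calc lam ^ p * θ (p - 1) ^ 2 ≤ lam ^ p * (θ' (p - 1) ^ 2 + 2 * δ) := by gcongr
          _ = _ := by ring
      rw [hE, hE', tailSum, tailSum,
        ← Finset.sum_Ico_consecutive _ (show k + 1 ≤ p by omega) (show p ≤ C + 1 by omega),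
        ← Finset.sum_Ico_consecutive _ (show k + 1 ≤ p by omega) (show p ≤ C + 1 by omega),
        Finset.sum_eq_sum_Ico_succ_bot (show p < C + 1 by omega),
        Finset.sum_eq_sum_Ico_succ_bot (show p < C + 1 by omega), hCp]
      linarith
    -- the decay of `θ'` makes up for the large coefficient `b λ ^ (k + 1)`
    have e2 : b * lam ^ (k + 1) * decay b (E' / D') ≤ 24 := by
      have f1 : lam ^ (k + 1) * (1 / 2) ^ 2 ≤ E' := by
        have := Finset.single_le_sum (f := fun i => lam ^ i * θ' (C - i) ^ 2)
          (fun i _ => by positivity)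
          (Finset.mem_Ico.2 ⟨le_rfl, (show k + 1 < C + 1 by omega)⟩)
        refine le_trans ?_ this
        have := hhalf (C - (k + 1)) (by omega) (by omega)
        gcongr
      have f2 : D' ≤ 2 := headSum_le hl.le hl2 h0 h1' k
      have f3 : lam ^ (k + 1) ≤ 8 * (E' / D') := by
        rw [mul_div_assoc', le_div_iff₀ hD0]
        have : 0 ≤ lam ^ (k + 1) := by positivity
        nlinarith
      have f4 : E' / D' ≤ 2 := by
        refine (div_le_self hE0 hD1).trans ((tailSum_le hl.le hl2 h0 h1' k).trans ?_)
        have := pow_le_one₀ (n := k + 1) hl.le (by linarith)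
        linarith
      have f5 := decay_mul_le (b := b) ht0 f4
      calc b * lam ^ (k + 1) * decay b (E' / D') ≤ b * (8 * (E' / D')) * decay b (E' / D') := by
            gcongr
        _ = 8 * (b * (E' / D') * decay b (E' / D')) := by ring
        _ ≤ 24 := by linarith
    have e3 : E - E' ≤ 4 * δ * lam ^ (k + 1) +
        (2 * δ * lam ^ p + 4 * (104 * δ) * lam ^ (p + 1)) := by linarith
    rw [hwt]
    calc decay b (E' / D') - decay b (E / D') ≤ b / 2 * decay b (E' / D') * (E - E') := hlinE
      _ ≤ b / 2 * decay b (E' / D') * (4 * δ * lam ^ (k + 1) +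
          (2 * δ * lam ^ p + 4 * (104 * δ) * lam ^ (p + 1))) := by gcongr
      _ = 2 * δ * (b * lam ^ (k + 1) * decay b (E' / D')) + decay b (E' / D') *
          (δ * (b * lam ^ p) + b / 2 * (4 * (104 * δ) * lam ^ (p + 1))) := by ring
      _ ≤ 2 * δ * 24 + 1 * (δ * 3 + (1 - q) / 2 * δ) := by
          gcongr
          linarith
      _ ≤ 104 * ((1 + q) / 2 * δ) := by linarith [mul_nonneg hq hδ0]
  · have hwt : coordWeight p k = 1 := if_neg (by omega)
    have hkp1 : p - 1 = k := by omega
    have hdk : θ k - θ' k ≤ δ := by have := hδ k hk; rwa [hwt, one_mul] at this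
    set e := ∑ i ∈ Finset.Ico (p + 1) (C + 1), lam ^ i * θ (C - i) ^ 2 with he
    set e' := ∑ i ∈ Finset.Ico (p + 1) (C + 1), lam ^ i * θ' (C - i) ^ 2 with he'
    have g1 : E = lam ^ p * θ k ^ 2 + e := by
      rw [hE, tailSum, hkp, Finset.sum_eq_sum_Ico_succ_bot (by omega), hCp, hkp1]
    have g2 : E' = lam ^ p * θ' k ^ 2 + e' := by
      rw [hE', tailSum, hkp, Finset.sum_eq_sum_Ico_succ_bot (by omega), hCp, hkp1]
    have he0 : 0 ≤ e' := Finset.sum_nonneg fun i _ => by positivity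
    have hee : e' ≤ e := by
      refine Finset.sum_le_sum fun i _ => ?_
      have := h0 (C - i) (by omega)
      have := hle (C - i) (by omega)
      gcongr
    have main := decay_sq_sub_le hb hq hγ (s := e' / D') (ν := lam ^ p / D') (by positivity)
      (by
        refine le_trans ?_ hm
        gcongr
        exact div_le_self (by positivity) hD1) (by positivity) (hle k hk)
    have r1 : e' / D' + lam ^ p / D' * θ' k ^ 2 = E' / D' := by rw [g2]; ring
    have r2 : e' / D' + lam ^ p / D' * θ k ^ 2 ≤ E / D' := by
      rw [g1, show e' / D' + lam ^ p / D' * θ k ^ 2 = (lam ^ p * θ k ^ 2 + e') / D' by ring]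
      gcongr
    have r0 : 0 ≤ e' / D' + lam ^ p / D' * θ k ^ 2 := by positivity
    have rest := decay_sub_le (b := b) r0 r2
    have r3 : E / D' - (e' / D' + lam ^ p / D' * θ k ^ 2) ≤ 4 * (104 * δ) * lam ^ (p + 1) := by
      rw [g1, show (lam ^ p * θ k ^ 2 + e) / D' - (e' / D' + lam ^ p / D' * θ k ^ 2) =
        (e - e') / D' by ring]
      exact (div_le_self (by linarith) hD1).trans (by linarith)
    have r4 := decay_le_one (b := b) r0
    have r5 : b / 2 * decay b (e' / D' + lam ^ p / D' * θ k ^ 2) *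
        (E / D' - (e' / D' + lam ^ p / D' * θ k ^ 2)) ≤ (1 - q) / 2 * δ := by
      refine le_trans ?_ hsmall
      have := decay_nonneg (b := b) (e' / D' + lam ^ p / D' * θ k ^ 2)
      have : 0 ≤ 4 * (104 * δ) * lam ^ (p + 1) := by positivity
      calc _ ≤ b / 2 * 1 * (4 * (104 * δ) * lam ^ (p + 1)) := by gcongr
        _ = _ := by ring
    rw [r1] at main
    have : q * (θ k - θ' k) ≤ q * δ := by gcongr
    rw [hwt, one_mul]
    linarith
  · have hwt : coordWeight p k = 1 := if_neg (by omega)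
    have e1 : E ≤ E' + 4 * (104 * δ) * lam ^ (p + 1) := by
      have := sum_Ico_le_of_sub_le (θ := θ) (θ' := θ') (C := C) (m := k + 1) (n := C + 1)
        hl.le hl2 h0 h1 hle (show 0 ≤ 104 * δ by positivity) fun i _ _ => hw i
      refine this.trans ?_
      rw [hE', tailSum]
      gcongr 1
      have := pow_le_pow_of_le_one hl.le (by linarith : lam ≤ 1) (show p + 1 ≤ k + 1 by omega)
      gcongr
    rw [hwt, one_mul]
    calc decay b (E' / D') - decay b (E / D') ≤ b / 2 * decay b (E' / D') * (E - E') := hlinE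
      _ ≤ b / 2 * 1 * (4 * (104 * δ) * lam ^ (p + 1)) := by gcongr; linarith
      _ = b / 2 * (4 * (104 * δ) * lam ^ (p + 1)) := by ring
      _ ≤ (1 - q) / 2 * δ := hsmall
      _ ≤ (1 + q) / 2 * δ := by gcongr; linarith

lemma half_le_thetaStep (hl : 0 < lam) (hl2 : lam ≤ 1 / 6) (hm : b * lam ^ p ≤ 3)
    (hC : θ C = 1) (h0 : ∀ k ≤ C, 0 ≤ θ k) (h1 : ∀ k ≤ C, θ k ≤ 1) {k : ℕ} (hk : p ≤ k) :
    1 / 2 ≤ thetaStep b C lam θ k := by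
  have hD := one_le_headSum hl.le hC k
  have hE := tailSum_le hl.le (by linarith) h0 h1 k
  have hE0 := tailSum_nonneg (C := C) (θ := θ) hl.le k
  have ht : 0 ≤ tailSum C lam θ k / headSum C lam θ k := by positivity
  have := decay_sub_le (b := b) le_rfl ht
  rw [decay_zero, sub_zero, mul_one] at this
  have h2 : tailSum C lam θ k / headSum C lam θ k ≤ 2 * lam ^ (p + 1) := by
    refine (div_le_self hE0 hD).trans (hE.trans ?_)
    have := pow_le_pow_of_le_one hl.le (by linarith : lam ≤ 1) (show p + 1 ≤ k + 1 by omega)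
    linarith
  have h3 : (b : ℝ) / 2 * (tailSum C lam θ k / headSum C lam θ k) ≤ 1 / 2 := by
    calc (b : ℝ) / 2 * (tailSum C lam θ k / headSum C lam θ k)
        ≤ b / 2 * (2 * lam ^ (p + 1)) := by gcongr
      _ = (b * lam ^ p) * lam := by ring
      _ ≤ 3 * (1 / 6) := by gcongr
      _ = 1 / 2 := by norm_num
  unfold thetaStep
  linarith

end Step

end Contraction

/-! ### Monotonicity in the boundary condition -/

section Order
variable {b C : ℕ} {lam : ℝ}

/-- The total weight of the spins up to `k`. -/
def cum (w : ℕ → ℝ) (k : ℕ) : ℝ := ∑ j ∈ Finset.range (k + 1), w j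

/-- The order on weights: the ratio of the cumulative weights of `w` to those of `w'` decreases. -/
def Dominated (C : ℕ) (w w' : ℕ → ℝ) : Prop :=
  ∀ j k, j ≤ k → k ≤ C → cum w' j * cum w k ≤ cum w j * cum w' k

/-- A monotone likelihood ratio implies the order on cumulative weights. -/
lemma dominated_of_ratio {Y Y' : ℕ → ℝ}
    (h : ∀ i l, i ≤ l → l ≤ C → Y i * Y' l ≤ Y' i * Y l) : Dominated C Y' Y := by
  intro j k hjk hk
  have hsplit : ∀ w : ℕ → ℝ, cum w k = cum w j + ∑ l ∈ Finset.Ico (j + 1) (k + 1), w l := by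
    intro w
    unfold cum
    rw [Finset.sum_range_add_sum_Ico _ (by omega)]
  rw [hsplit Y, hsplit Y', mul_add, mul_add, mul_comm (cum Y j) (cum Y' j)]
  refine add_le_add_right ?_ _
  unfold cum
  rw [Finset.sum_mul_sum, Finset.sum_mul_sum]
  refine Finset.sum_le_sum fun i hi => Finset.sum_le_sum fun l hl => h i l ?_ ?_
  · rw [Finset.mem_range] at hi; rw [Finset.mem_Ico] at hl; omega
  · rw [Finset.mem_Ico] at hl; omega

lemma cum_nonneg {w : ℕ → ℝ} (h : ∀ i, 0 ≤ w i) (k : ℕ) : 0 ≤ cum w k :=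
  Finset.sum_nonneg fun _ _ => h _

lemma subtreeStep_nonneg (hl : 0 ≤ lam) {W : List (Fin b) → ℕ → ℝ} (h : ∀ v i, 0 ≤ W v i)
    (v : List (Fin b)) (i : ℕ) : 0 ≤ subtreeStep C lam W v i :=
  mul_nonneg (pow_nonneg hl _)
    (Finset.prod_nonneg fun _ _ => Finset.sum_nonneg fun _ _ => h _ _)

/-- Passing to the parent reverses the order. -/
lemma Dominated.subtreeStep (hl : 0 ≤ lam) {W W' : List (Fin b) → ℕ → ℝ}
    (h0 : ∀ v i, 0 ≤ W v i) (h0' : ∀ v i, 0 ≤ W' v i) (h : ∀ v, Dominated C (W v) (W' v))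
    (v : List (Fin b)) : Dominated C (subtreeStep C lam W' v) (subtreeStep C lam W v) := by
  refine dominated_of_ratio fun i l hil hl' => ?_
  have key : (∏ c : Fin b, cum (W (c :: v)) (C - i)) * ∏ c : Fin b, cum (W' (c :: v)) (C - l) ≤
      (∏ c : Fin b, cum (W' (c :: v)) (C - i)) * ∏ c : Fin b, cum (W (c :: v)) (C - l) := by
    rw [← Finset.prod_mul_distrib, ← Finset.prod_mul_distrib]
    refine Finset.prod_le_prod
      (fun c _ => mul_nonneg (cum_nonneg (h0 _) _) (cum_nonneg (h0' _) _)) fun c _ => ?_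
    have := h (c :: v) (C - l) (C - i) (by omega) (by omega)
    linarith
  have hpow : 0 ≤ lam ^ i * lam ^ l := by positivity
  have := mul_le_mul_of_nonneg_left key hpow
  simp only [MultiHardCore.subtreeStep]
  unfold cum at this
  linarith

lemma cum_subtreeStep_pos (hl : 0 ≤ lam) {W : List (Fin b) → ℕ → ℝ} (h0 : ∀ v i, 0 ≤ W v i)
    (h : ∀ v, 0 < cum (W v) C) (v : List (Fin b)) : 0 < cum (subtreeStep C lam W v) C := by
  refine Finset.sum_pos' (fun i _ => subtreeStep_nonneg hl h0 v i)
    ⟨0, Finset.mem_range.2 (Nat.succ_pos _), ?_⟩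
  simp only [MultiHardCore.subtreeStep, pow_zero, one_mul]
  exact Finset.prod_pos fun c _ => h _

/-- The distribution function of the spin with weights `w`. -/
def distFn (C : ℕ) (w : ℕ → ℝ) (k : ℕ) : ℝ := cum w k / cum w C

lemma Dominated.distFn_le {w w' : ℕ → ℝ} (h : Dominated C w w') (hw : 0 < cum w C)
    (hw' : 0 < cum w' C) {k : ℕ} (hk : k ≤ C) : distFn C w' k ≤ distFn C w k := by
  unfold distFn
  rw [div_le_div_iff₀ hw' hw]
  exact h k C hk le_rfl

lemma distFn_nonneg {w : ℕ → ℝ} (h : ∀ i, 0 ≤ w i) (k : ℕ) : 0 ≤ distFn C w k :=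
  div_nonneg (cum_nonneg h _) (cum_nonneg h _)

lemma cum_mono {w : ℕ → ℝ} (h : ∀ i, 0 ≤ w i) {j k : ℕ} (hjk : j ≤ k) : cum w j ≤ cum w k :=
  Finset.sum_le_sum_of_subset_of_nonneg (Finset.range_mono (by omega)) fun _ _ _ => h _

lemma distFn_le_one {w : ℕ → ℝ} (h : ∀ i, 0 ≤ w i) {k : ℕ} (hk : k ≤ C) : distFn C w k ≤ 1 :=
  div_le_one_of_le₀ (cum_mono h hk) (cum_nonneg h _)

/-- The weights of subtrees with all boundary spins equal to `C`. One level up these are the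
weights of subtrees with all boundary spins equal to `0`, so that the two extremal boundary
conditions give the same sequence, up to a shift. -/
def extremal (b C : ℕ) (lam : ℝ) (n : ℕ) : ℕ → ℝ :=
  (homStep b C lam)^[n] fun i => if i = C then 1 else 0

lemma extremal_succ (n : ℕ) : extremal b C lam (n + 1) = homStep b C lam (extremal b C lam n) :=
  Function.iterate_succ_apply' _ _ _

lemma extremal_nonneg (hl : 0 ≤ lam) (n i : ℕ) : 0 ≤ extremal b C lam n i := by
  induction n generalizing i with
  | zero => simp only [extremal, Function.iterate_zero, id]; split_ifs <;> norm_num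
  | succ n ih => rw [extremal_succ]; exact homStep_nonneg hl ih i

lemma homStep_eq (z : ℕ → ℝ) (i : ℕ) : homStep b C lam z i = lam ^ i * cum z (C - i) ^ b := rfl

lemma cum_extremal_zero (k : ℕ) (hk : k ≤ C) :
    cum (extremal b C lam 0) k = if k = C then 1 else 0 := by
  simp only [extremal, Function.iterate_zero, id, cum, Finset.sum_ite_eq', Finset.mem_range]
  exact if_congr (by omega) rfl rfl

lemma extremal_one (hb : 1 ≤ b) (i : ℕ) (hi : i ≤ C) :
    extremal b C lam 1 i = if i = 0 then 1 else 0 := by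
  rw [extremal_succ, homStep_eq, cum_extremal_zero _ (by omega)]
  by_cases h : i = 0
  · simp [h]
  · rw [if_neg (by omega), if_neg h, zero_pow (by omega), mul_zero]

lemma cum_extremal_one (hb : 1 ≤ b) (k : ℕ) (hk : k ≤ C) : cum (extremal b C lam 1) k = 1 := by
  rw [cum, Finset.sum_eq_single 0]
  · rw [extremal_one hb _ (by omega), if_pos rfl]
  · intro i hi h
    rw [Finset.mem_range] at hi
    rw [extremal_one hb _ (by omega), if_neg h]
  · simp

lemma cum_extremal_pos (hl : 0 ≤ lam) (n : ℕ) : 0 < cum (extremal b C lam n) C := by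
  induction n with
  | zero => rw [cum_extremal_zero _ le_rfl]; simp
  | succ n ih =>
    refine Finset.sum_pos' (fun i _ => extremal_nonneg hl _ i)
      ⟨0, Finset.mem_range.2 (Nat.succ_pos _), ?_⟩
    rw [extremal_succ, homStep_eq]
    simpa using pow_pos ih b

lemma Dominated.homStep (hl : 0 ≤ lam) {z z' : ℕ → ℝ} (h0 : ∀ i, 0 ≤ z i) (h0' : ∀ i, 0 ≤ z' i)
    (h : Dominated C z z') : Dominated C (homStep b C lam z') (homStep b C lam z) := by
  have := Dominated.subtreeStep (b := b) (lam := lam) hl (W := fun _ => z) (W' := fun _ => z')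
    (fun _ => h0) (fun _ => h0') (fun _ => h) []
  rwa [subtreeStep_const, subtreeStep_const] at this

/-- Consecutive members of the extremal sequence are ordered, in alternating directions. -/
lemma extremal_dominated (hb : 1 ≤ b) (hl : 0 ≤ lam) (n : ℕ) :
    if Even n then Dominated C (extremal b C lam (n + 1)) (extremal b C lam n)
    else Dominated C (extremal b C lam n) (extremal b C lam (n + 1)) := by
  induction n with
  | zero =>
    rw [if_pos Even.zero]
    intro j k hjk hk
    rw [zero_add, cum_extremal_zero _ (hjk.trans hk), cum_extremal_zero _ hk,
      cum_extremal_one hb _ (hjk.trans hk), cum_extremal_one hb _ hk]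
    split_ifs <;> first | omega | norm_num
  | succ n ih =>
    have h1 := extremal_nonneg (b := b) (C := C) hl n
    have h2 := extremal_nonneg (b := b) (C := C) hl (n + 1)
    by_cases hn : Even n
    · rw [if_pos hn] at ih
      rw [if_neg (by rw [Nat.even_add_one]; exact not_not.2 hn)]
      have := ih.homStep (b := b) hl h2 h1
      rwa [← extremal_succ, ← extremal_succ] at this
    · rw [if_neg hn] at ih
      rw [if_pos (by rw [Nat.even_add_one]; exact hn)]
      have := ih.homStep (b := b) hl h1 h2
      rwa [← extremal_succ, ← extremal_succ] at this

variable (τ : List (Fin b) → Fin (C + 1))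

lemma subtreeWeight_nonneg (hl : 0 ≤ lam) (n : ℕ) (v : List (Fin b)) (i : ℕ) :
    0 ≤ (subtreeStep C lam)^[n] (pinned τ) v i := by
  induction n generalizing v i with
  | zero => simp only [Function.iterate_zero, id, pinned]; split_ifs <;> norm_num
  | succ n ih => rw [Function.iterate_succ_apply']; exact subtreeStep_nonneg hl ih v i

lemma cum_pinned (v : List (Fin b)) (k : ℕ) :
    cum (pinned τ v) k = if (τ v : ℕ) ≤ k then 1 else 0 := by
  simp only [cum, pinned, Finset.sum_ite_eq', Finset.mem_range]
  exact if_congr (by omega) rfl rfl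

lemma cum_subtreeWeight_pos (hl : 0 ≤ lam) (n : ℕ) (v : List (Fin b)) :
    0 < cum ((subtreeStep C lam)^[n] (pinned τ) v) C := by
  induction n generalizing v with
  | zero =>
    simp only [Function.iterate_zero, id]
    rw [cum_pinned, if_pos (Nat.le_of_lt_succ (τ v).2)]; norm_num
  | succ n ih =>
    rw [Function.iterate_succ_apply']
    exact cum_subtreeStep_pos hl (subtreeWeight_nonneg τ hl n) ih v

/-- All boundary conditions lie between the two extremal ones. -/
lemma subtreeWeight_between (hb : 1 ≤ b) (hl : 0 ≤ lam) (n : ℕ) (v : List (Fin b)) :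
    if Even n then Dominated C (extremal b C lam (n + 1)) ((subtreeStep C lam)^[n] (pinned τ) v) ∧
        Dominated C ((subtreeStep C lam)^[n] (pinned τ) v) (extremal b C lam n)
    else Dominated C (extremal b C lam n) ((subtreeStep C lam)^[n] (pinned τ) v) ∧
        Dominated C ((subtreeStep C lam)^[n] (pinned τ) v) (extremal b C lam (n + 1)) := by
  induction n generalizing v with
  | zero =>
    rw [if_pos Even.zero]
    simp only [Function.iterate_zero, id]
    have hτ := (τ v).2
    constructor
    · intro j k hjk hk
      rw [zero_add, cum_extremal_one hb _ (hjk.trans hk), cum_extremal_one hb _ hk, cum_pinned, cum_pinned]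
      split_ifs <;> first | omega | norm_num
    · intro j k hjk hk
      rw [cum_extremal_zero _ (by omega), cum_extremal_zero _ hk, cum_pinned, cum_pinned]
      split_ifs <;> first | omega | norm_num
  | succ n ih =>
    rw [Function.iterate_succ_apply', extremal_succ n, extremal_succ (n + 1)]
    have h0 := subtreeWeight_nonneg (lam := lam) τ hl n
    have h1 := extremal_nonneg (b := b) (C := C) hl n
    have h2 := extremal_nonneg (b := b) (C := C) hl (n + 1)
    by_cases hn : Even n
    · simp only [if_pos hn] at ih
      rw [if_neg (by rw [Nat.even_add_one]; exact not_not.2 hn)]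
      constructor
      · have := Dominated.subtreeStep hl h0 (W' := fun _ => extremal b C lam n) (fun _ => h1)
          (fun v => (ih v).2) v
        rwa [subtreeStep_const] at this
      · have := Dominated.subtreeStep hl (W := fun _ => extremal b C lam (n + 1)) (fun _ => h2) h0
          (fun v => (ih v).1) v
        rwa [subtreeStep_const] at this
    · simp only [if_neg hn] at ih
      rw [if_pos (by rw [Nat.even_add_one]; exact hn)]
      constructor
      · have := Dominated.subtreeStep hl h0 (W' := fun _ => extremal b C lam (n + 1)) (fun _ => h2)
          (fun v => (ih v).2) v
        rwa [subtreeStep_const] at this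
      · have := Dominated.subtreeStep hl (W := fun _ => extremal b C lam n) (fun _ => h1) h0
          (fun v => (ih v).1) v
        rwa [subtreeStep_const] at this

end Order

/-! ### Convergence of the extremal sequence -/

section Limit
variable {b C p : ℕ} {lam : ℝ}

/-- The extremal sequence in the coordinates in which the recursion contracts. -/
def extremalTheta (b C : ℕ) (lam : ℝ) (n k : ℕ) : ℝ :=
  Real.sqrt (distFn C (extremal b C lam n) k) ^ b

lemma extremalTheta_nonneg (n k : ℕ) : 0 ≤ extremalTheta b C lam n k := by
  unfold extremalTheta; positivity

lemma extremalTheta_le_one (hl : 0 ≤ lam) (n : ℕ) {k : ℕ} (hk : k ≤ C) :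
    extremalTheta b C lam n k ≤ 1 := by
  refine pow_le_one₀ (Real.sqrt_nonneg _) ?_
  rw [Real.sqrt_le_one]
  exact distFn_le_one (extremal_nonneg hl n) hk

lemma extremalTheta_sq (hl : 0 ≤ lam) (n k : ℕ) :
    extremalTheta b C lam n k ^ 2 = distFn C (extremal b C lam n) k ^ b := by
  rw [extremalTheta, ← pow_mul, mul_comm, pow_mul,
    Real.sq_sqrt (distFn_nonneg (extremal_nonneg hl n) k)]

lemma extremalTheta_top (hl : 0 ≤ lam) (n : ℕ) : extremalTheta b C lam n C = 1 := by
  rw [extremalTheta, distFn, div_self (cum_extremal_pos hl n).ne', Real.sqrt_one, one_pow]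

lemma extremalTheta_succ (hl : 0 ≤ lam) (n : ℕ) {k : ℕ} (hk : k ≤ C) :
    extremalTheta b C lam (n + 1) k = thetaStep b C lam (extremalTheta b C lam n) k := by
  set θ := extremalTheta b C lam n with hθ
  set T := cum (extremal b C lam n) C with hT
  have hT0 : 0 < T := cum_extremal_pos hl n
  have hterm : ∀ i, extremal b C lam (n + 1) i = lam ^ i * θ (C - i) ^ 2 * T ^ b := by
    intro i
    rw [extremal_succ, homStep_eq, hθ, extremalTheta_sq hl, distFn, ← hT, div_pow]
    field_simp
  have h1 : cum (extremal b C lam (n + 1)) k = headSum C lam θ k * T ^ b := by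
    rw [cum, headSum, Finset.sum_mul, Finset.range_eq_Ico]
    exact Finset.sum_congr rfl fun i _ => hterm i
  have h2 : cum (extremal b C lam (n + 1)) C = (headSum C lam θ k + tailSum C lam θ k) * T ^ b := by
    rw [cum, headSum, tailSum, Finset.sum_Ico_consecutive _ (Nat.zero_le _) (by omega),
      Finset.sum_mul, Finset.range_eq_Ico]
    exact Finset.sum_congr rfl fun i _ => hterm i
  have hD : 0 < headSum C lam θ k :=
    lt_of_lt_of_le one_pos (one_le_headSum hl (extremalTheta_top hl n) k)
  rw [extremalTheta, distFn, h1, h2, mul_div_mul_right _ _ (pow_pos hT0 b).ne', thetaStep, decay,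
    ← inv_pow, ← Real.sqrt_inv]
  congr 2
  rw [one_add_div hD.ne', inv_div]

lemma extremalTheta_one (hb : 1 ≤ b) {k : ℕ} (hk : k ≤ C) : extremalTheta b C lam 1 k = 1 := by
  rw [extremalTheta, distFn, cum_extremal_one hb _ hk, cum_extremal_one hb _ le_rfl]
  simp

lemma half_le_extremalTheta (hb : 1 ≤ b) (hl : 0 < lam) (hl2 : lam ≤ 1 / 6)
    (hm : b * lam ^ p ≤ 3) (n : ℕ) {k : ℕ} (hk : k ≤ C) (hpk : p ≤ k) :
    1 / 2 ≤ extremalTheta b C lam (n + 1) k := by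
  match n with
  | 0 => rw [extremalTheta_one hb hk]; norm_num
  | n + 1 =>
    rw [extremalTheta_succ hl.le _ hk]
    exact half_le_thetaStep hl hl2 hm (extremalTheta_top hl.le _)
      (fun k _ => extremalTheta_nonneg _ k) (fun k hk => extremalTheta_le_one hl.le _ hk) hpk

lemma extremalTheta_le_of_dominated (hl : 0 ≤ lam) {m n : ℕ}
    (h : Dominated C (extremal b C lam m) (extremal b C lam n)) {k : ℕ} (hk : k ≤ C) :
    extremalTheta b C lam n k ≤ extremalTheta b C lam m k := by
  unfold extremalTheta
  have := h.distFn_le (cum_extremal_pos hl m) (cum_extremal_pos hl n) hk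
  gcongr

/-- The hypotheses of subcriticality under which the recursion contracts, in quantitative form. -/
structure Subcritical (b p : ℕ) (lam q : ℝ) : Prop where
  one_le : 1 ≤ b
  lam_pos : 0 < lam
  q_nonneg : 0 ≤ q
  le_three : b * lam ^ p ≤ 3
  le_sq_mul : b * lam ^ p ≤ q ^ 2 * (1 + 1 / (b : ℝ)) ^ (b - 1)
  lam_le : 1248 * lam ≤ 1 - q

lemma abs_extremalTheta_sub_le {q : ℝ} (hs : Subcritical b p lam q) (hp : C + 1 = 2 * p) (n : ℕ) :
    ∀ k ≤ C, |extremalTheta b C lam (n + 1) k - extremalTheta b C lam (n + 2) k| ≤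
      coordWeight p k * ((1 + q) / 2) ^ n := by
  have hl := hs.lam_pos
  have hq := hs.q_nonneg
  have hl6 : lam ≤ 1 / 6 := by linarith [hs.lam_le]
  induction n with
  | zero =>
    intro k hk
    have h1 := one_le_coordWeight p k
    have h2 := extremalTheta_nonneg (b := b) (C := C) (lam := lam) 2 k
    have h3 := extremalTheta_le_one (b := b) hl.le 2 hk
    rw [extremalTheta_one hs.one_le hk, pow_zero, mul_one, abs_le]
    constructor <;> linarith
  | succ n ih =>
    intro k hk
    have hδ0 : 0 ≤ ((1 + q) / 2) ^ n := by positivity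
    have hdom := extremal_dominated (b := b) (C := C) hs.one_le hl.le (n + 1)
    have hdom' := extremal_dominated (b := b) (C := C) hs.one_le hl.le (n + 2)
    rw [pow_succ']
    have step : ∀ m m', Dominated C (extremal b C lam (m + 1)) (extremal b C lam (m' + 1)) →
        (∀ k ≤ C, extremalTheta b C lam (m + 1) k - extremalTheta b C lam (m' + 1) k ≤
          coordWeight p k * ((1 + q) / 2) ^ n) →
        extremalTheta b C lam (m' + 2) k - extremalTheta b C lam (m + 2) k ≤
          coordWeight p k * ((1 + q) / 2 * ((1 + q) / 2) ^ n) := by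
      intro m m' hd hd'
      rw [extremalTheta_succ hl.le (m' + 1) hk, extremalTheta_succ hl.le (m + 1) hk]
      exact thetaStep_sub_le hs.one_le hp hl hq hs.le_three hs.le_sq_mul le_rfl hs.lam_le
        (extremalTheta_top hl.le _) (fun k _ => extremalTheta_nonneg _ k)
        (fun k hk => extremalTheta_le_one hl.le _ hk)
        (fun k hk => extremalTheta_le_of_dominated hl.le hd hk)
        (fun k hk hpk => half_le_extremalTheta hs.one_le hl hl6 hs.le_three _ hk hpk)
        hδ0 hd' hk
    by_cases hn : Even (n + 1)
    · rw [if_pos hn] at hdom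
      rw [if_neg (by rw [show n + 2 = n + 1 + 1 by rfl, Nat.even_add_one]; exact not_not.2 hn)]
        at hdom'
      have := extremalTheta_le_of_dominated hl.le hdom' hk
      rw [abs_of_nonneg (by linarith)]
      exact step (n + 1) n hdom fun k hk => by
        have := (abs_le.1 (ih k hk)).1; linarith
    · rw [if_neg hn] at hdom
      rw [if_pos (by rw [show n + 2 = n + 1 + 1 by rfl, Nat.even_add_one]; exact hn)] at hdom'
      have := extremalTheta_le_of_dominated hl.le hdom' hk
      rw [abs_sub_comm, abs_of_nonneg (by linarith)]
      exact step n (n + 1) hdom fun k hk => (abs_le.1 (ih k hk)).2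

lemma exists_tendsto_distFn_extremal {q : ℝ} (hs : Subcritical b p lam q) (hp : C + 1 = 2 * p) :
    ∃ F : ℕ → ℝ, ∀ k ≤ C, Filter.Tendsto (fun n => distFn C (extremal b C lam n) k) Filter.atTop
      (nhds (F k)) := by
  have hl := hs.lam_pos
  have hb0 : (0 : ℝ) < b := by exact_mod_cast hs.one_le
  have key : ∀ k, ∃ x, k ≤ C → Filter.Tendsto (fun n => distFn C (extremal b C lam n) k)
      Filter.atTop (nhds x) := by
    intro k
    by_cases hk : k ≤ C
    · have hcauchy : CauchySeq fun n => extremalTheta b C lam (n + 1) k := by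
        refine cauchySeq_of_le_geometric ((1 + q) / 2) (coordWeight p k)
          (by linarith [hs.lam_le]) fun n => ?_
        rw [Real.dist_eq]
        exact abs_extremalTheta_sub_le hs hp n k hk
      obtain ⟨x, hx⟩ := cauchySeq_tendsto_of_complete hcauchy
      have h2 := (hx.pow 2).rpow_const (p := (b : ℝ)⁻¹) (Or.inr (by positivity))
      refine ⟨_, fun _ => (Filter.tendsto_add_atTop_iff_nat 1).1 (h2.congr fun n => ?_)⟩
      rw [extremalTheta_sq hl.le, Real.pow_rpow_inv_natCast
        (distFn_nonneg (extremal_nonneg hl.le _) k) (by have := hs.one_le; omega)]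
    · exact ⟨0, fun h => absurd h hk⟩
  choose F hF using key
  exact ⟨F, fun k hk => hF k hk⟩

lemma le_distFn_extremal (hl : 0 < lam) (hl1 : lam ≤ 1) (n : ℕ) :
    1 / ((C : ℝ) + 1) ≤ distFn C (extremal b C lam (n + 1)) 0 := by
  have hT := cum_extremal_pos (b := b) (C := C) hl.le n
  have h0 : cum (extremal b C lam (n + 1)) 0 = cum (extremal b C lam n) C ^ b := by
    rw [extremal_succ]; simp [cum, homStep_eq]
  have h1 : cum (extremal b C lam (n + 1)) C ≤ (C + 1) * cum (extremal b C lam n) C ^ b := by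
    have : ∀ i ∈ Finset.range (C + 1), extremal b C lam (n + 1) i ≤
        cum (extremal b C lam n) C ^ b := by
      intro i _
      rw [extremal_succ, homStep_eq]
      have h2 := cum_mono (extremal_nonneg (b := b) (C := C) hl.le n) (Nat.sub_le C i)
      have h3 := cum_nonneg (extremal_nonneg (b := b) (C := C) hl.le n) (C - i)
      calc lam ^ i * cum (extremal b C lam n) (C - i) ^ b
          ≤ 1 * cum (extremal b C lam n) C ^ b := by
            gcongr
            exact pow_le_one₀ hl.le hl1
        _ = _ := one_mul _
    have := Finset.sum_le_card_nsmul _ _ _ this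
    simpa [cum] using this
  rw [distFn, h0, div_le_div_iff₀ (by positivity) (cum_extremal_pos hl.le _)]
  linarith

/-- The spin at the root of a subtree has a limit law that does not depend on the boundary
condition. -/
lemma exists_tendsto_subtreeWeight {q : ℝ} (hs : Subcritical b p lam q) (hp : C + 1 = 2 * p) :
    ∃ π : ℕ → ℝ, 0 < π 0 ∧ (∀ i ≤ C, 0 ≤ π i) ∧ ∀ (τ : List (Fin b) → Fin (C + 1)) v, ∀ i ≤ C,
      Filter.Tendsto (fun n => (subtreeStep C lam)^[n] (pinned τ) v i /
        cum ((subtreeStep C lam)^[n] (pinned τ) v) C) Filter.atTop (nhds (π i)) := by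
  have hl := hs.lam_pos
  obtain ⟨F, hF⟩ := exists_tendsto_distFn_extremal hs hp
  have hW : ∀ (τ : List (Fin b) → Fin (C + 1)) v, ∀ k ≤ C, Filter.Tendsto
      (fun n => distFn C ((subtreeStep C lam)^[n] (pinned τ) v) k) Filter.atTop (nhds (F k)) := by
    intro τ v k hk
    have f1 := hF k hk
    have f2 := (Filter.tendsto_add_atTop_iff_nat 1).2 f1
    have hmin := f1.min f2
    have hmax := f1.max f2
    rw [min_self] at hmin
    rw [max_self] at hmax
    refine tendsto_of_tendsto_of_tendsto_of_le_of_le hmin hmax (fun n => ?_) fun n => ?_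
    all_goals
      have hbt := subtreeWeight_between (lam := lam) τ hs.one_le hl.le n v
      have p1 := cum_extremal_pos (b := b) (C := C) hl.le n
      have p2 := cum_extremal_pos (b := b) (C := C) hl.le (n + 1)
      have p3 := cum_subtreeWeight_pos (lam := lam) τ hl.le n v
      split_ifs at hbt
    · exact min_le_of_left_le (hbt.2.distFn_le p3 p1 hk)
    · exact min_le_of_right_le (hbt.2.distFn_le p3 p2 hk)
    · exact le_max_of_le_right (hbt.1.distFn_le p2 p3 hk)
    · exact le_max_of_le_left (hbt.1.distFn_le p1 p3 hk)
  have hπ : ∀ (τ : List (Fin b) → Fin (C + 1)) v, ∀ i ≤ C,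
      Filter.Tendsto (fun n => (subtreeStep C lam)^[n] (pinned τ) v i /
        cum ((subtreeStep C lam)^[n] (pinned τ) v) C) Filter.atTop
          (nhds (if i = 0 then F 0 else F i - F (i - 1))) := by
    intro τ v i hi
    match i with
    | 0 =>
      refine (hW τ v 0 hi).congr fun n => ?_
      simp [distFn, cum]
    | i + 1 =>
      rw [if_neg (Nat.succ_ne_zero i), Nat.add_sub_cancel]
      refine ((hW τ v (i + 1) hi).sub (hW τ v i (by omega))).congr fun n => ?_
      rw [distFn, distFn, ← sub_div]
      congr 1
      rw [cum, cum, Finset.sum_range_succ]; ring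
  refine ⟨_, ?_, fun i hi => ?_, hπ⟩
  · rw [if_pos rfl]
    refine lt_of_lt_of_le (show 0 < 1 / ((C : ℝ) + 1) by positivity)
      (ge_of_tendsto ((Filter.tendsto_add_atTop_iff_nat 1).2 (hF 0 (Nat.zero_le _)))
        (Filter.Eventually.of_forall fun n => le_distFn_extremal hl ?_ n))
    have := hs.q_nonneg
    linarith [hs.lam_le]
  · refine ge_of_tendsto (hπ (fun _ => 0) [] i hi) (Filter.Eventually.of_forall fun n => ?_)
    exact div_nonneg (subtreeWeight_nonneg _ hl.le n _ i) (cum_subtreeWeight_pos _ hl.le n _).le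

end Limit

/-! ### Uniqueness -/

section Uniqueness
open Filter
variable {b C p : ℕ} {lam : ℝ}

/-- The weight of a configuration on the first `k + 1` levels when the last of them carries the
weights `W`. -/
def levelWeight (lam : ℝ) (k : ℕ) (W : List (Fin b) → ℕ → ℝ) (σ : List (Fin b) → Fin (C + 1)) : ℝ :=
  ballWeight lam k σ * ∏ v ∈ level b k, W v (σ v)

lemma ballWeight_nonneg (hl : 0 ≤ lam) (k : ℕ) (σ : List (Fin b) → Fin (C + 1)) :
    0 ≤ ballWeight lam k σ := by
  rw [← hullWeight_ball]; exact hullWeight_nonneg hl _ _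

lemma dependsOn_levelWeight (k : ℕ) (W : List (Fin b) → ℕ → ℝ) :
    DependsOn (levelWeight (C := C) lam k W) (ball b (k + 1) : Set (List (Fin b))) := by
  intro σ σ' h
  unfold levelWeight
  rw [dependsOn_ballWeight k h]
  congr 1
  refine Finset.prod_congr rfl fun v hv => ?_
  rw [h v (by rw [mem_level] at hv; simp [hv])]

lemma levelWeight_div (k : ℕ) (W : List (Fin b) → ℕ → ℝ) (T : List (Fin b) → ℝ)
    (σ : List (Fin b) → Fin (C + 1)) : levelWeight lam k (fun v i => W v i / T v) σ =
      levelWeight lam k W σ / ∏ v ∈ level b k, T v := by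
  rw [levelWeight, levelWeight, Finset.prod_div_distrib, mul_div_assoc]

lemma ballWeight_apply_zero (k : ℕ) : ballWeight (b := b) (C := C) lam k (fun _ => 0) = 1 :=
  Finset.prod_eq_one fun v _ => by simp [vertexWeight, compat]

lemma siteSum_eq_of_dependsOn {U : Finset (List (Fin b))}
    {φ : (List (Fin b) → Fin (C + 1)) → ℝ} (h : DependsOn φ (U : Set (List (Fin b))))
    (σ σ' : List (Fin b) → Fin (C + 1)) : siteSum U φ σ = siteSum U φ σ' :=
  siteSum_dependsOn h fun _ hv => absurd hv.1 hv.2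

/-- In the subcritical regime the finite-volume probabilities of a cylinder event have a limit
that does not depend on the boundary condition. -/
lemma exists_tendsto_finite_volume {q : ℝ} (hs : Subcritical b p lam q) (hp : C + 1 = 2 * p)
    (k : ℕ) (f : (List (Fin b) → Fin (C + 1)) → ℝ)
    (hf : DependsOn f (ball b (k + 1) : Set (List (Fin b)))) :
    ∃ L : ℝ, ∀ τ : List (Fin b) → Fin (C + 1), Tendsto (fun m =>
      siteSum (ball b (k + m + 1))
        (fun σ => hullWeight (tree b) C lam (ball b (k + m + 1)) σ * f σ) τ /
      siteSum (ball b (k + m + 1)) (hullWeight (tree b) C lam (ball b (k + m + 1))) τ)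
      atTop (nhds L) := by
  have hl := hs.lam_pos
  obtain ⟨π, hπ0, hπ, hlim⟩ := exists_tendsto_subtreeWeight (C := C) hs hp
  let S : ((List (Fin b) → Fin (C + 1)) → ℝ) → (List (Fin b) → Fin (C + 1)) → ℝ := fun g τ =>
    siteSum (ball b (k + 1)) (fun σ => levelWeight lam k (fun _ => π) σ * g σ) τ
  have hS : ∀ g, DependsOn g (ball b (k + 1) : Set (List (Fin b))) → ∀ τ, S g τ = S g fun _ => 0 :=
    fun g hg τ => siteSum_eq_of_dependsOn (fun σ σ' h => by
      simp only [hg h, dependsOn_levelWeight k (fun _ => π) h]) _ _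
  have hpos : 0 < S (fun _ => 1) fun _ => 0 := by
    refine siteSum_pos (fun σ => ?_) (fun _ => 0) ?_
    · rw [mul_one]
      exact mul_nonneg (ballWeight_nonneg hl.le _ _)
        (Finset.prod_nonneg fun v _ => hπ _ (Nat.le_of_lt_succ (Fin.isLt _)))
    · rw [glue_zero, mul_one, levelWeight, ballWeight_apply_zero, one_mul]
      exact Finset.prod_pos fun v _ => hπ0
  refine ⟨S f (fun _ => 0) / S (fun _ => 1) fun _ => 0, fun τ => ?_⟩
  -- the weights of the subtrees at level `k`, divided by their totals
  let W : ℕ → List (Fin b) → ℕ → ℝ := fun m => (subtreeStep C lam)^[m + 1] (pinned τ)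
  have hconv : ∀ g, DependsOn g (ball b (k + 1) : Set (List (Fin b))) → Tendsto (fun m =>
      siteSum (ball b (k + m + 1))
        (fun σ => hullWeight (tree b) C lam (ball b (k + m + 1)) σ * g σ) τ /
          ∏ v ∈ level b k, cum (W m v) C) atTop (nhds (S g fun _ => 0)) := by
    intro g hg
    rw [← hS g hg τ]
    have e : ∀ m, siteSum (ball b (k + m + 1))
        (fun σ => hullWeight (tree b) C lam (ball b (k + m + 1)) σ * g σ) τ /
          ∏ v ∈ level b k, cum (W m v) C =
        siteSum (ball b (k + 1)) (fun σ =>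
          levelWeight lam k (fun v i => W m v i / cum (W m v) C) σ * g σ) τ := by
      intro m
      rw [siteSum_hullWeight_ball k m hg τ, siteSum, siteSum, Finset.sum_div]
      refine Finset.sum_congr rfl fun ξ _ => ?_
      rw [levelWeight_div]
      simp only [levelWeight, W]
      ring
    simp only [e]
    refine tendsto_finsetSum _ fun ξ _ => Tendsto.mul_const _ (Tendsto.const_mul _ ?_)
    refine tendsto_finsetProd _ fun v _ => ?_
    exact (tendsto_add_atTop_iff_nat 1).2 (hlim τ v _ (Nat.le_of_lt_succ (Fin.isLt _)))
  refine ((hconv f hf).div (hconv (fun _ => 1) fun _ _ _ => rfl) hpos.ne').congr fun m => ?_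
  have hT : ∏ v ∈ level b k, cum (W m v) C ≠ 0 :=
    (Finset.prod_pos fun v _ => cum_subtreeWeight_pos τ hl.le _ v).ne'
  simp only [Pi.div_apply, mul_one]
  rw [div_div_div_cancel_right₀ hT]

theorem existsUnique_isGibbs_of_subcritical {q : ℝ} (hs : Subcritical b p lam q)
    (hp : C + 1 = 2 * p) : ∃! μ : Measure (List (Fin b) → Fin (C + 1)),
      IsGibbs (tree b) C lam μ := by
  have hl := hs.lam_pos
  obtain ⟨μ, hμ, -⟩ := exists_isGibbs_tendsto (C := C) hl finite_boundary_tree (ball b)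
    eventually_subset_ball (Ultrafilter.of atTop) (Ultrafilter.of_le _)
  refine ⟨μ, hμ, fun ν hν => ?_⟩
  have hμ' := hμ.isProbabilityMeasure
  have hν' := hν.isProbabilityMeasure
  refine measure_eq_of_forall_cyl (fun n => ball b (n + 1))
    (fun U => (exists_subset_ball U).imp fun n hn => hn.trans (ball_mono (Nat.le_succ n)))
    fun k ξ => ?_
  obtain ⟨L, hL⟩ := exists_tendsto_finite_volume hs hp k (cyl (ball b (k + 1)) ξ)
    (dependsOn_cyl _ ξ)
  have key : ∀ ρ : Measure (List (Fin b) → Fin (C + 1)), IsGibbs (tree b) C lam ρ →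
      ∫ σ, cyl (ball b (k + 1)) ξ σ ∂ρ = L := by
    intro ρ hρ
    have := hρ.isProbabilityMeasure
    have hint : ∀ m, ∫ σ, cyl (ball b (k + 1)) ξ σ ∂ρ = ∫ τ, siteSum (ball b (k + m + 1))
        (fun σ => hullWeight (tree b) C lam (ball b (k + m + 1)) σ * cyl (ball b (k + 1)) ξ σ) τ /
        siteSum (ball b (k + m + 1)) (hullWeight (tree b) C lam (ball b (k + m + 1))) τ ∂ρ :=
      fun m => hρ.integral_eq finite_boundary_tree _ fun σ σ' h => dependsOn_cyl _ ξ
        fun v hv => h v (ball_mono (by omega) hv)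
    have hlim := tendsto_integral_of_dominated_convergence (μ := ρ) (f := fun _ => L)
      (fun _ => (1 : ℝ)) (F := fun m τ => siteSum (ball b (k + m + 1))
        (fun σ => hullWeight (tree b) C lam (ball b (k + m + 1)) σ * cyl (ball b (k + 1)) ξ σ) τ /
        siteSum (ball b (k + m + 1)) (hullWeight (tree b) C lam (ball b (k + m + 1))) τ)
      (fun m => ?_) (integrable_const _) (fun m => Eventually.of_forall fun τ => ?_)
      (Eventually.of_forall hL)
    · have hconst : ∫ _, L ∂ρ = L := by simp
      rw [hconst] at hlim
      exact tendsto_nhds_unique (tendsto_const_nhds.congr hint) hlim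
    · have hdep : DependsOn (hullWeight (tree b) C lam (ball b (k + m + 1)))
          (ball b (k + m + 2) : Set (List (Fin b))) := by
        have : hullWeight (tree b) C lam (ball b (k + m + 1)) = ballWeight lam (k + m + 1) :=
          funext (hullWeight_ball _)
        rw [this]
        exact dependsOn_ballWeight _
      refine (Measurable.mono (measurable_of_dependsOn (W := ball b (k + m + 2))
        (Set.subset_univ _) ?_) cylinderEvents_le_pi le_rfl).aestronglyMeasurable
      intro σ σ' h
      have d1 := siteSum_dependsOn (U := ball b (k + m + 1)) hdep (fun v hv => h v hv.1)
      have d2 := siteSum_dependsOn (U := ball b (k + m + 1))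
        (W := (ball b (k + m + 2) : Set (List (Fin b))))
        (φ := fun σ => hullWeight (tree b) C lam (ball b (k + m + 1)) σ *
          cyl (ball b (k + 1)) ξ σ)
        (fun σ σ' h => by
          have h1 := hdep h
          have h2 := dependsOn_cyl (ball b (k + 1)) ξ fun v hv => h v (ball_mono (by omega) hv)
          simp only [h1, h2]) (fun v hv => h v hv.1)
      simp only [d1, d2]
    · have hcyl : ∀ σ, 0 ≤ cyl (ball b (k + 1)) ξ σ ∧ cyl (ball b (k + 1)) ξ σ ≤ 1 := fun σ => by
        classical
        rw [cyl_apply]; split_ifs <;> norm_num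
      have hZ := siteSum_nonneg (U := ball b (k + m + 1)) (σ := τ)
        (hullWeight_nonneg (G := tree b) (C := C) hl.le (ball b (k + m + 1)))
      rw [Real.norm_of_nonneg (div_nonneg (siteSum_nonneg fun σ =>
        mul_nonneg (hullWeight_nonneg hl.le _ _) (hcyl σ).1) hZ)]
      refine div_le_one_of_le₀ (Finset.sum_le_sum fun η _ => ?_) hZ
      exact mul_le_of_le_one_right (hullWeight_nonneg hl.le _ _) (hcyl _).2
  rw [key μ hμ, key ν hν]

theorem exists_existsUnique_isGibbs (hC : Odd C) {γ : ℝ} (hγ0 : 0 < γ) (hγ : γ < Real.exp 1) :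
    ∃ b₀ : ℕ, ∀ b : ℕ, b₀ ≤ b → ∀ lam : ℝ, 0 < lam →
        lam ≤ (γ / (b : ℝ)) ^ (1 / (jc C : ℝ)) →
          ∃! μ : Measure (List (Fin b) → Fin (C + 1)), IsGibbs (tree b) C lam μ := by
  have hp := jc_spec hC
  have hp1 : 1 ≤ jc C := by omega
  have he := Real.exp_pos 1
  -- `q ^ 2` lies strictly between `γ / e` and `1`
  set r := (γ / Real.exp 1 + 1) / 2 with hr
  have hge : γ / Real.exp 1 < 1 := (div_lt_one he).2 hγ
  have hg0 : 0 < γ / Real.exp 1 := by positivity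
  have hr0 : 0 < r := by linarith
  have hr1 : r < 1 := by linarith
  have hγr : γ / r < Real.exp 1 := by
    rw [div_lt_iff₀ hr0, mul_comm, ← div_lt_iff₀ he]; linarith
  set q := Real.sqrt r with hq
  have hq0 : 0 ≤ q := Real.sqrt_nonneg _
  have hq1 : q < 1 := by rw [hq, Real.sqrt_lt' one_pos]; linarith
  have hq2 : q ^ 2 = r := Real.sq_sqrt hr0.le
  have t1 : Tendsto (fun b : ℕ => (1 + 1 / (b : ℝ)) ^ (b - 1)) atTop (nhds (Real.exp 1)) := by
    have h1 := Real.tendsto_one_add_div_pow_exp 1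
    have h2 : Tendsto (fun b : ℕ => 1 + 1 / (b : ℝ)) atTop (nhds (1 + 0)) :=
      tendsto_const_nhds.add tendsto_one_div_atTop_nhds_zero_nat
    have h3 := h1.div h2 (by norm_num)
    rw [add_zero, div_one] at h3
    refine h3.congr' ?_
    filter_upwards [eventually_ge_atTop 1] with b hb
    have hb0 : (0 : ℝ) < b := by exact_mod_cast hb
    have : (1 + 1 / (b : ℝ)) ^ b = (1 + 1 / (b : ℝ)) ^ (b - 1) * (1 + 1 / (b : ℝ)) := by
      rw [← pow_succ, Nat.sub_add_cancel hb]
    simp only [Pi.div_apply]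
    rw [this, mul_div_assoc, div_self (by positivity), mul_one]
  have t2 := t1.eventually (lt_mem_nhds hγr)
  set s := (1 - q) / 1248 with hs
  have hs0 : 0 < s := by rw [hs]; linarith
  have t3 : ∀ᶠ b : ℕ in atTop, γ / s ^ jc C < b :=
    tendsto_natCast_atTop_atTop.eventually (eventually_gt_atTop _)
  obtain ⟨b₁, hb₁⟩ := eventually_atTop.1 (t2.and t3)
  refine ⟨max 1 b₁, fun b hb lam hl hle => ?_⟩
  have hb1 : 1 ≤ b := (le_max_left _ _).trans hb
  have hb0 : (0 : ℝ) < b := by exact_mod_cast hb1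
  obtain ⟨g1, g2⟩ := hb₁ b ((le_max_right _ _).trans hb)
  have hm := mul_pow_le_of_le_rpow hγ0 hb1 hp1 hl hle
  have h3 : Real.exp 1 < 3 := Real.exp_one_lt_d9.trans (by norm_num)
  refine existsUnique_isGibbs_of_subcritical (q := q) ⟨hb1, hl, hq0, by linarith, ?_, ?_⟩ hp
  · rw [hq2]
    rw [div_lt_iff₀ hr0] at g1
    linarith
  · have : lam ^ jc C ≤ s ^ jc C := by
      rw [div_lt_iff₀ (by positivity)] at g2
      refine le_of_mul_le_mul_left ?_ hb0
      linarith
    have := (pow_le_pow_iff_left₀ hl.le hs0.le (by omega)).1 this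
    rw [hs, le_div_iff₀ (by norm_num)] at this
    linarith

end Uniqueness

end MultiHardCore

end

theorem theorem4p1 (C : ℕ) (hC : Odd C) :
    (∀ γ : ℝ, Real.exp 1 < γ →
      (∀ lamBar : ℝ, lamBar < 1 → ∃ b₀ : ℕ, ∀ b : ℕ, b₀ ≤ b → ∀ lam : ℝ,
        (γ / (b : ℝ)) ^ (1 / (MultiHardCore.jc C : ℝ)) ≤ lam → lam ≤ lamBar →
          ∃ x y : ℝ,
            IsLeast (MultiHardCore.fixedPts (MultiHardCore.upperMap b C lam)) x ∧
            IsGreatest (MultiHardCore.fixedPts (MultiHardCore.lowerMap b C lam)) y ∧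
            x < y) ∧
      (∃ b₀ : ℕ, ∀ b : ℕ, b₀ ≤ b → ∀ lam : ℝ,
        (γ / (b : ℝ)) ^ (1 / (MultiHardCore.jc C : ℝ)) ≤ lam → lam < 1 →
          MultiHardCore.PhaseCoexistence (MultiHardCore.tree b) C lam)) ∧
    (∀ γ' : ℝ, 0 < γ' → γ' < Real.exp 1 →
      ∃ b₀ : ℕ, ∀ b : ℕ, b₀ ≤ b → ∀ lam : ℝ, 0 < lam →
        lam ≤ (γ' / (b : ℝ)) ^ (1 / (MultiHardCore.jc C : ℝ)) →
          ∃! μ : MeasureTheory.Measure (List (Fin b) → Fin (C + 1)),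
            MultiHardCore.IsGibbs (MultiHardCore.tree b) C lam μ) :=
  ⟨fun _ hγ => ⟨fun lamBar hl => MultiHardCore.exists_extremal_fixedPts hC hγ lamBar hl,
    MultiHardCore.exists_phaseCoexistence hC hγ⟩,
    fun _ hγ0 hγ => MultiHardCore.exists_existsUnique_isGibbs hC hγ0 hγ⟩
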